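/- Let $M$ be a compact smooth Riemannian manifold without boundary, with gradient $\nabla$ and volume measure $dx$, and write $\langle f,g\rangle=\int_M fg\,dx$. The space $C^\infty(M)$ carries its Fréchet topology, and smoothness of maps on open subsets of $C^\infty(M)$ is understood in the usual sense (equivalently: smooth finite-dimensional families of functions are sent to smooth families). For a functional $G$ on an open set of $C^\infty(M)$, $\delta G(f)\in C^\infty(M)$ denotes its first variation ($L^2$ gradient), defined by $\frac{d}{d\varepsilon}\big|_{\varepsilon=0}G(f+\varepsilon\varphi)=\langle \delta G(f),\varphi\rangle$ for all $\varphi\in C^\infty(M)$; partial $L^2$ gradients are written $\partial_\rho,\partial_S,\partial_\eta,\partial_{\eta^*}$. The second variation $\delta^2G(f)$ is the operator $\varphi\mapsto \frac{d}{d\varepsilon}\big|_{\varepsilon=0}\delta G(f+\varepsilon\varphi)$ on $C^\infty(M)$. Let $U\subset C^\infty(M)$ be open and let $\mathcal F\colon U\to\mathbb R$ be a smooth functional possessing a smooth first variation $\delta\mathcal F\colon U\to C^\infty(M)$ which is smoothly invertible: $\delta\mathcal F$ is injective on $U$, $\delta\mathcal F(U)$ is open, and $(\delta\mathcal F)^{-1}\colon\delta\mathcal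 F(U)\to U$ is smooth. Put $$\mathcal H(\rho,S)=\tfrac12\int_M|\nabla S|^2\rho\,dx-\tfrac12\int_M|\nabla\delta\mathcal F(\rho)|^2\rho\,dx ,\qquad \rho\in U,\ S\in C^\infty(M).$$ For $\eta,\eta^*\in U$ with $\delta\mathcal F(\eta)+\delta\mathcal F(\eta^*)\in\delta\mathcal F(U)$, the Hopf–Cole transformation is $s(\eta,\eta^*)=(\rho,S)$, where $\rho\in U$ and $$\delta\mathcal F(\rho)=\delta\mathcal F(\eta)+\delta\mathcal F(\eta^*),\qquad S=\delta\mathcal F(\eta)-\delta\mathcal F(\eta^*).$$ Let $\mathcal K=\mathcal H\circ s$ and, with this $\rho$, let $$\sigma(\eta,\eta^*)=-\tfrac12\,[\delta^2\mathcal F(\eta)]^{-1}\,\delta^2\mathcal F(\rho)\,[\delta^2\mathcal F(\eta^*)]^{-1}.$$ Then $\delta^2\mathcal F(f)\colon C^\infty(M)\to C^\infty(M)$ is bijective for every $f\in U$, so that $\sigma$ is well defined on the domain of $s$. Moreover: (1) Let $J\subset\mathbb R$ be open (for instance $J=(0,T)$), and let $(\rho_t,S_t)_{t\in J}$ be a solution,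 smooth on $J\times M$, of the Wasserstein Hamiltonian flow $$\partial_t\rho_t=\partial_S\mathcal H(\rho_t,S_t),\qquad \partial_tS_t=-\partial_\rho\mathcal H(\rho_t,S_t),$$ where each $\rho_t\in U$ is a strictly positive probability density. Suppose $(\rho_t,S_t)=s(\eta_t,\eta^*_t)$ for all $t\in J$, where $(\eta_t,\eta_t^*)$ lies in the domain of $s$. Then $\eta_t,\eta^*_t$ are smooth on $J\times M$, the partial $L^2$ gradients of $\mathcal K$ exist at $(\eta_t,\eta_t^*)$, and for all $t\in J$ $$\partial_t\eta_t=\sigma(\eta_t,\eta^*_t)\,\partial_{\eta^*}\mathcal K(\eta_t,\eta^*_t),\qquad \partial_t\eta^*_t=-\sigma(\eta^*_t,\eta_t)\,\partial_\eta\mathcal K(\eta_t,\eta^*_t).$$ (2) For every $(\eta,\eta^*)$ in the domain of $s$ and all $\alpha,\beta\in C^\infty(M)$, $$\langle\sigma(\eta,\eta^*)\alpha,\beta\rangle=-\tfrac12\langle\delta^2\mathcal F(\rho)\bar\alpha,\bar\beta\rangle,\quad\text{where } \delta^2\mathcal F(\eta^*)\bar\alpha=\alpha,\ \ \delta^2\mathcal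 F(\eta)\bar\beta=\beta ,$$ and $\sigma(\eta^*,\eta)$ is the adjoint of $\sigma(\eta,\eta^*)$: $\langle\sigma(\eta^*,\eta)\alpha,\beta\rangle=\langle\alpha,\sigma(\eta,\eta^*)\beta\rangle$. -/

import Mathlib

open MeasureTheory Bundle Manifold
open scoped ContDiff

noncomputable section

namespace HopfCole

section Calculus

variable {d : ℕ} {M : Type*} [TopologicalSpace M] [ChartedSpace (EuclideanSpace ℝ (Fin d)) M]

/-- A family `v ↦ p v` of smooth functions on `M`, with parameter `v` in a subset `O` of a
normed space, is smooth if `(v, x) ↦ p v x` is smooth on `O × M`. -/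
def SmoothFamily {P : Type*} [NormedAddCommGroup P] [NormedSpace ℝ P] (O : Set P)
    (p : P → C^∞⟮𝓡 d, M; ℝ⟯) : Prop :=
  ContMDiffOn (𝓘(ℝ, P).prod (𝓡 d)) 𝓘(ℝ, ℝ) ∞ (fun q : P × M => p q.1 q.2) (O ×ˢ Set.univ)

/-- `U` is open in `C^∞(M)`: its preimage under every smooth finite-dimensional family is open
(the `c^∞`-topology, which for compact `M` is the Fréchet topology of `C^∞(M)`). -/
def IsOpenSmooth (U : Set C^∞⟮𝓡 d, M; ℝ⟯) : Prop :=
  ∀ (P : Type) [NormedAddCommGroup P] [NormedSpace ℝ P] [FiniteDimensional ℝ P]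
    (O : Set P) (p : P → C^∞⟮𝓡 d, M; ℝ⟯), IsOpen O → SmoothFamily O p →
      IsOpen {v | v ∈ O ∧ p v ∈ U}

/-- `F` is a smooth functional on `U`: it sends smooth finite-dimensional families in `U` to
smooth functions of the parameter. -/
def SmoothFunctionalOn (U : Set C^∞⟮𝓡 d, M; ℝ⟯) (F : C^∞⟮𝓡 d, M; ℝ⟯ → ℝ) : Prop :=
  ∀ (P : Type) [NormedAddCommGroup P] [NormedSpace ℝ P] [FiniteDimensional ℝ P]
    (O : Set P) (p : P → C^∞⟮𝓡 d, M; ℝ⟯), IsOpen O → SmoothFamily O p → (∀ v ∈ O, p v ∈ U) →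
      ContDiffOn ℝ ∞ (fun v => F (p v)) O

/-- `Φ` is a smooth map from `U` to `C^∞(M)`: it sends smooth finite-dimensional families in `U`
to smooth families. -/
def SmoothMapOn (U : Set C^∞⟮𝓡 d, M; ℝ⟯) (Φ : C^∞⟮𝓡 d, M; ℝ⟯ → C^∞⟮𝓡 d, M; ℝ⟯) : Prop :=
  ∀ (P : Type) [NormedAddCommGroup P] [NormedSpace ℝ P] [FiniteDimensional ℝ P]
    (O : Set P) (p : P → C^∞⟮𝓡 d, M; ℝ⟯), IsOpen O → SmoothFamily O p → (∀ v ∈ O, p v ∈ U) →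
      SmoothFamily O (fun v => Φ (p v))

/-- `g` is the derivative at `t` of the path `τ ↦ f τ` of smooth functions. -/
def HasPathDeriv (f : ℝ → C^∞⟮𝓡 d, M; ℝ⟯) (g : C^∞⟮𝓡 d, M; ℝ⟯) (t : ℝ) : Prop :=
  ∀ x : M, HasDerivAt (fun τ => f τ x) (g x) t

open Classical in
/-- The derivative of `Φ` at `f` in the direction `φ` (and `0` if it does not exist). -/
def dirDeriv (Φ : C^∞⟮𝓡 d, M; ℝ⟯ → C^∞⟮𝓡 d, M; ℝ⟯) (f φ : C^∞⟮𝓡 d, M; ℝ⟯) :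
    C^∞⟮𝓡 d, M; ℝ⟯ :=
  if h : ∃ g, HasPathDeriv (fun ε : ℝ => Φ (f + ε • φ)) g 0 then h.choose else 0

end Calculus

section Geometry

variable {d : ℕ} {M : Type*} [EMetricSpace M] [MeasurableSpace M] [BorelSpace M]
  [ChartedSpace (EuclideanSpace ℝ (Fin d)) M]

/-- The Riemannian volume measure of a `d`-dimensional Riemannian manifold: the `d`-dimensional
Hausdorff measure of the Riemannian distance, normalized so as to agree with Lebesgue measure on
Euclidean space. -/
def vol (d : ℕ) (M : Type*) [EMetricSpace M] [MeasurableSpace M] [BorelSpace M] : Measure M :=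
  μHE[d]

/-- The set `P₊(M)` of smooth, strictly positive probability densities. -/
def densityManifold (d : ℕ) (M : Type*) [EMetricSpace M] [MeasurableSpace M] [BorelSpace M]
    [ChartedSpace (EuclideanSpace ℝ (Fin d)) M] : Set C^∞⟮𝓡 d, M; ℝ⟯ :=
  {ρ | (∀ x, 0 < ρ x) ∧ ∫ x, ρ x ∂(vol d M) = 1}

/-- The `L²` pairing of two smooth functions. -/
def pairing (f g : C^∞⟮𝓡 d, M; ℝ⟯) : ℝ := ∫ x, f x * g x ∂(vol d M)

/-- `g` is the first variation (`L²` gradient) of the functional `F` at `f`. -/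
def HasFirstVariation (F : C^∞⟮𝓡 d, M; ℝ⟯ → ℝ) (f g : C^∞⟮𝓡 d, M; ℝ⟯) : Prop :=
  ∀ φ : C^∞⟮𝓡 d, M; ℝ⟯, HasDerivAt (fun ε : ℝ => F (f + ε • φ)) (pairing g φ) 0

open Classical in
/-- The first variation `δF(f)` (and `0` if it does not exist). -/
def firstVariation (F : C^∞⟮𝓡 d, M; ℝ⟯ → ℝ) (f : C^∞⟮𝓡 d, M; ℝ⟯) : C^∞⟮𝓡 d, M; ℝ⟯ :=
  if h : ∃ g, HasFirstVariation F f g then h.choose else 0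

/-- The second variation (`L²` Hessian) `δ²F(f)`, as an operator on `C^∞(M)`: the derivative
of `δF` at `f`. -/
def secondVariation (F : C^∞⟮𝓡 d, M; ℝ⟯ → ℝ) (f : C^∞⟮𝓡 d, M; ℝ⟯) :
    C^∞⟮𝓡 d, M; ℝ⟯ → C^∞⟮𝓡 d, M; ℝ⟯ :=
  dirDeriv (firstVariation F) f

/-- The inverse operator `[δ²F(f)]⁻¹`. -/
def secondVariationInv (F : C^∞⟮𝓡 d, M; ℝ⟯ → ℝ) (f : C^∞⟮𝓡 d, M; ℝ⟯) :
    C^∞⟮𝓡 d, M; ℝ⟯ → C^∞⟮𝓡 d, M; ℝ⟯ :=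
  Function.invFun (secondVariation F f)

/-- `F` is a smooth potential on the open set `U ⊆ C^∞(M)`, with a smooth first variation
`δF : U → C^∞(M)`. -/
structure IsSmoothPotential (U : Set C^∞⟮𝓡 d, M; ℝ⟯) (F : C^∞⟮𝓡 d, M; ℝ⟯ → ℝ) : Prop where
  isOpen : IsOpenSmooth U
  smooth : SmoothFunctionalOn U F
  hasFirstVariation : ∀ f ∈ U, ∃ g, HasFirstVariation F f g
  smooth_firstVariation : SmoothMapOn U (firstVariation F)

/-- The inverse `(δF)⁻¹ : δF(U) → U` of the first variation. -/
def firstVariationInv (U : Set C^∞⟮𝓡 d, M; ℝ⟯) (F : C^∞⟮𝓡 d, M; ℝ⟯ → ℝ) :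
    C^∞⟮𝓡 d, M; ℝ⟯ → C^∞⟮𝓡 d, M; ℝ⟯ :=
  Function.invFunOn (firstVariation F) U

/-- `δF` is smoothly invertible on `U`: it is injective on `U`, with open image and smooth
inverse. -/
structure IsInvertibleFirstVariation (U : Set C^∞⟮𝓡 d, M; ℝ⟯) (F : C^∞⟮𝓡 d, M; ℝ⟯ → ℝ) :
    Prop where
  injOn : Set.InjOn (firstVariation F) U
  isOpen_image : IsOpenSmooth (firstVariation F '' U)
  smooth_inv : SmoothMapOn (firstVariation F '' U) (firstVariationInv U F)

/-- The domain of the Hopf--Cole transformation: pairs `(η, η*)` in `U` for which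
`δF(ρ) = δF(η) + δF(η*)` has a solution `ρ` in `U`. -/
def hopfColeDomain (U : Set C^∞⟮𝓡 d, M; ℝ⟯) (F : C^∞⟮𝓡 d, M; ℝ⟯ → ℝ) :
    Set (C^∞⟮𝓡 d, M; ℝ⟯ × C^∞⟮𝓡 d, M; ℝ⟯) :=
  {q | q.1 ∈ U ∧ q.2 ∈ U ∧ firstVariation F q.1 + firstVariation F q.2 ∈ firstVariation F '' U}

/-- The Hopf--Cole transformation `s(η, η*) = (ρ, S)`, where `δF(ρ) = δF(η) + δF(η*)` and
`S = δF(η) - δF(η*)`. -/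
def hopfCole (U : Set C^∞⟮𝓡 d, M; ℝ⟯) (F : C^∞⟮𝓡 d, M; ℝ⟯ → ℝ)
    (q : C^∞⟮𝓡 d, M; ℝ⟯ × C^∞⟮𝓡 d, M; ℝ⟯) : C^∞⟮𝓡 d, M; ℝ⟯ × C^∞⟮𝓡 d, M; ℝ⟯ :=
  (firstVariationInv U F (firstVariation F q.1 + firstVariation F q.2),
    firstVariation F q.1 - firstVariation F q.2)

/-- The operator
`σ(η, η*) = -½ [δ²F(η)]⁻¹ δ²F(ρ) [δ²F(η*)]⁻¹`, where `ρ = (δF)⁻¹(δF(η) + δF(η*))`. -/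
def sigma (U : Set C^∞⟮𝓡 d, M; ℝ⟯) (F : C^∞⟮𝓡 d, M; ℝ⟯ → ℝ) (η ηs α : C^∞⟮𝓡 d, M; ℝ⟯) :
    C^∞⟮𝓡 d, M; ℝ⟯ :=
  (-(1 / 2) : ℝ) • secondVariationInv F η
    (secondVariation F (hopfCole U F (η, ηs)).1 (secondVariationInv F ηs α))

variable [RiemannianBundle (fun x : M => TangentSpace (𝓡 d) x)]

instance instCompleteSpaceTangentSpace (d : ℕ) (M : Type*) [EMetricSpace M]
    [ChartedSpace (EuclideanSpace ℝ (Fin d)) M]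
    [RiemannianBundle (fun x : M => TangentSpace (𝓡 d) x)] (x : M) :
    CompleteSpace (TangentSpace (𝓡 d) x) :=
  haveI : FiniteDimensional ℝ (TangentSpace (𝓡 d) x) :=
    inferInstanceAs (FiniteDimensional ℝ (EuclideanSpace ℝ (Fin d)))
  FiniteDimensional.complete ℝ _

/-- The Riemannian gradient `∇f(x) ∈ T_x M`: the Riesz representative of the differential of `f`
at `x` for the Riemannian inner product on `T_x M`. -/
def grad (f : C^∞⟮𝓡 d, M; ℝ⟯) (x : M) : TangentSpace (𝓡 d) x :=
  (InnerProductSpace.toDual ℝ (TangentSpace (𝓡 d) x)).symm (mvfderiv (𝓡 d) f x)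

/-- The Hamiltonian `H(ρ, S) = ½ ∫ |∇S|² ρ dx - ½ ∫ |∇δF(ρ)|² ρ dx`. -/
def hamiltonian (F : C^∞⟮𝓡 d, M; ℝ⟯ → ℝ) (ρ S : C^∞⟮𝓡 d, M; ℝ⟯) : ℝ :=
  1 / 2 * ∫ x, ‖grad S x‖ ^ 2 * ρ x ∂(vol d M) -
    1 / 2 * ∫ x, ‖grad (firstVariation F ρ) x‖ ^ 2 * ρ x ∂(vol d M)

/-- The Hamiltonian `K = H ∘ s` in the Hopf--Cole variables. -/
def hopfColeHamiltonian (U : Set C^∞⟮𝓡 d, M; ℝ⟯) (F : C^∞⟮𝓡 d, M; ℝ⟯ → ℝ)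
    (η ηs : C^∞⟮𝓡 d, M; ℝ⟯) : ℝ :=
  hamiltonian F (hopfCole U F (η, ηs)).1 (hopfCole U F (η, ηs)).2

/-- `(ρ_t, S_t)`, `t ∈ J`, is a smooth solution with `ρ_t ∈ U ∩ P₊(M)` of the Wasserstein
Hamiltonian flow `∂_t ρ_t = ∂_S H(ρ_t, S_t)`, `∂_t S_t = -∂_ρ H(ρ_t, S_t)`, where `∂_S` and `∂_ρ`
are partial `L²` gradients. -/
structure IsHamiltonianFlow (J : Set ℝ) (U : Set C^∞⟮𝓡 d, M; ℝ⟯) (F : C^∞⟮𝓡 d, M; ℝ⟯ → ℝ)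
    (ρ S : ℝ → C^∞⟮𝓡 d, M; ℝ⟯) : Prop where
  smooth_density : SmoothFamily J ρ
  smooth_momentum : SmoothFamily J S
  mem_domain : ∀ t ∈ J, ρ t ∈ U
  mem_density : ∀ t ∈ J, ρ t ∈ densityManifold d M
  density_eq : ∀ t ∈ J, ∃ g, HasFirstVariation (fun T => hamiltonian F (ρ t) T) (S t) g ∧
    HasPathDeriv ρ g t
  momentum_eq : ∀ t ∈ J, ∃ g, HasFirstVariation (fun r => hamiltonian F r (S t)) (ρ t) g ∧
    HasPathDeriv S (-g) t

end Geometry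

end HopfCole

end

open MeasureTheory Bundle Manifold
open scoped ContDiff

noncomputable section

namespace HopfCole

/-! ### Calculus of smooth families and smooth paths in C^∞(M). -/

section SmoothFamilies

variable {d : ℕ} {M : Type*} [TopologicalSpace M] [ChartedSpace (EuclideanSpace ℝ (Fin d)) M]
  {P Q : Type*} [NormedAddCommGroup P] [NormedSpace ℝ P] [NormedAddCommGroup Q] [NormedSpace ℝ Q]
  {O : Set P} {p q : P → C^∞⟮𝓡 d, M; ℝ⟯}

/-! Write a = δF(η), b = δF(η*). In these variables the transformation is linear: δF(ρ) = a + b, S =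
a - b. Let g₁ = ∂_S H and g₂ = ∂_ρ H. The chain rule and the symmetry of second variations give ∂_η
K = δ²F(η)([δ²F(ρ)]⁻¹g₂ + g₁) and ∂_{η*} K = δ²F(η*)([δ²F(ρ)]⁻¹g₂ - g₁). Along the flow,
differentiating δF(η) = ½(δF(ρ) + S) yields δ²F(η)∂_tη = ½(δ²F(ρ)g₁ - g₂) = -½
δ²F(ρ)[δ²F(η*)]⁻¹∂_{η*}K, which is the first equation; the second comes from ½(δF(ρ) - S). Explicit
formulas for g₁ and g₂ are never needed.

The work lies in justifying this calculus when smoothness is known only on finite-dimensional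
families. Hadamard's lemma writes a smooth path as p(t) + εψ(ε) with ψ smooth. This reduces the
chain rule `SmoothMapOn.hasPathDeriv_comp` to an ordinary derivative in two real parameters. Applied
to δF and its inverse, it makes δ²F bijective (`bijective_secondVariation`); Schwarz's theorem for
(s, r) ↦ F(f + sφ + rψ) makes it symmetric (`IsSmoothPotential.pairing_secondVariation_comm`). These
two facts also give the statements on σ.

The flow supplies partial gradients of H at one point only, which alone would not yield a joint
derivative. `SmoothFamily.hasDerivAt_energy` computes that derivative as an integral that splits
into its two partial parts. It relies on joint continuity of inner products of gradients and on
finiteness of the volume of M, the latter from local Lipschitz bounds on inverse charts. -/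

lemma SmoothFamily.mono {O' : Set P} (hp : SmoothFamily O p) (h : O' ⊆ O) : SmoothFamily O' p :=
  ContMDiffOn.mono hp (Set.prod_mono h le_rfl)

lemma SmoothFamily.congr (hp : SmoothFamily O p) (h : ∀ v ∈ O, q v = p v) : SmoothFamily O q :=
  ContMDiffOn.congr hp fun v hv => by simp only [h v.1 hv.1]

lemma smoothFamily_const (f : C^∞⟮𝓡 d, M; ℝ⟯) : SmoothFamily O (fun _ => f) :=
  (f.contMDiff.comp contMDiff_snd).contMDiffOn

lemma SmoothFamily.add (hp : SmoothFamily O p) (hq : SmoothFamily O q) :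
    SmoothFamily O (fun v => p v + q v) :=
  ContMDiffOn.add hp hq

lemma SmoothFamily.sub (hp : SmoothFamily O p) (hq : SmoothFamily O q) :
    SmoothFamily O (fun v => p v - q v) :=
  ContMDiffOn.sub hp hq

lemma SmoothFamily.smul {c : P → ℝ} (hc : ContDiffOn ℝ ∞ c O) (hp : SmoothFamily O p) :
    SmoothFamily O (fun v => c v • p v) := by
  have : ContMDiffOn (𝓘(ℝ, P).prod (𝓡 d)) 𝓘(ℝ, ℝ) ∞ (fun q : P × M => c q.1) (O ×ˢ Set.univ) :=
    (contMDiffOn_iff_contDiffOn.2 hc).comp contMDiffOn_fst fun v hv => hv.1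
  exact ContMDiffOn.smul this hp

lemma SmoothFamily.comp {O' : Set Q} {θ : Q → P} (hp : SmoothFamily O p)
    (hθ : ContDiffOn ℝ ∞ θ O') (h : Set.MapsTo θ O' O) : SmoothFamily O' (fun w => p (θ w)) := by
  have : ContMDiffOn (𝓘(ℝ, Q).prod (𝓡 d)) 𝓘(ℝ, P) ∞ (fun q : Q × M => θ q.1) (O' ×ˢ Set.univ) :=
    (contMDiffOn_iff_contDiffOn.2 hθ).comp contMDiffOn_fst fun v hv => hv.1
  exact ContMDiffOn.comp (t := O ×ˢ Set.univ) hp (this.prodMk contMDiffOn_snd)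
    fun v hv => ⟨h hv.1, trivial⟩

lemma SmoothFamily.contDiffOn_apply (hp : SmoothFamily O p) (x : M) :
    ContDiffOn ℝ ∞ (fun v => p v x) O := by
  rw [← contMDiffOn_iff_contDiffOn]
  exact ContMDiffOn.comp (t := O ×ˢ Set.univ) hp (contMDiffOn_id.prodMk contMDiffOn_const)
    fun v hv => ⟨hv, trivial⟩

/-- A smooth family, read in the chart at `x₀`. -/
lemma SmoothFamily.contDiffOn_chart [IsManifold (𝓡 d) ∞ M] (hp : SmoothFamily O p) (x₀ : M) :
    ContDiffOn ℝ ∞ (fun z : P × EuclideanSpace ℝ (Fin d) => p z.1 ((extChartAt (𝓡 d) x₀).symm z.2))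
      (O ×ˢ (extChartAt (𝓡 d) x₀).target) := by
  rw [← contMDiffOn_iff_contDiffOn, modelWithCornersSelf_prod, ← chartedSpaceSelf_prod]
  exact ContMDiffOn.comp (t := O ×ˢ Set.univ) hp
    (contMDiffOn_fst.prodMk ((contMDiffOn_extChartAt_symm x₀).comp contMDiffOn_snd
      fun z hz => hz.2)) fun v hv => ⟨hv.1, trivial⟩

/-- The parametric integral `∫₀¹ h (s ε) y ds` depends smoothly on `(ε, y)`. -/
lemma contDiffOn_integral_comp_mul {E : Type*} [NormedAddCommGroup E] [NormedSpace ℝ E]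
    {W : Set E} (hW : IsOpen W) {h : ℝ × E → ℝ} (hh : ContDiffOn ℝ ∞ h (Set.univ ×ˢ W)) :
    ContDiffOn ℝ ∞ (fun z : ℝ × E => ∫ s in (0 : ℝ)..1, h (s * z.1, z.2)) (Set.univ ×ˢ W) := by
  -- The integral is the convolution at 0 of the indicator of (0, 1] with t ↦ h(-tε, y). The cutoff,
  -- equal to 1 on [-1, 1], supplies compact support without changing that value.
  let χ : ContDiffBump (0 : ℝ) := ⟨1, 2, one_pos, one_lt_two⟩
  let g : ℝ × E → ℝ → ℝ := fun z t => χ t * h (-t * z.1, z.2)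
  have hg : ContDiffOn ℝ ∞ (↿g) ((Set.univ ×ˢ W) ×ˢ Set.univ) := by
    refine ContDiffOn.mul (χ.contDiff.comp contDiff_snd).contDiffOn ?_
    refine hh.comp (t := Set.univ ×ˢ W) (ContDiff.contDiffOn (by fun_prop)) ?_
    exact fun z hz => ⟨trivial, hz.1.2⟩
  have key := contDiffOn_convolution_right_with_param (μ := (volume : Measure ℝ))
    (f := Set.indicator (Set.Ioc (0 : ℝ) 1) 1) (n := ⊤) (ContinuousLinearMap.mul ℝ ℝ)
    (isOpen_univ.prod hW) (isCompact_closedBall (0 : ℝ) 2) (g := g)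
    (fun z t _ ht => by
      have : χ t = 0 := by
        apply χ.zero_of_le_dist
        simpa using (not_le.1 (by simpa using ht)).le
      simp [g, this])
    ((locallyIntegrable_const (1 : ℝ)).indicator measurableSet_Ioc) hg
  have key' := key.comp (s := Set.univ ×ˢ W) (f := fun z : ℝ × E => (z, (0 : ℝ)))
    (ContDiff.contDiffOn (by fun_prop)) fun z hz => ⟨hz, trivial⟩
  refine key'.congr fun z hz => ?_
  simp only [Function.comp, MeasureTheory.convolution, ContinuousLinearMap.mul_apply']
  rw [intervalIntegral.integral_of_le zero_le_one, ← integral_indicator measurableSet_Ioc]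
  refine integral_congr_ae (Filter.Eventually.of_forall fun t => ?_)
  by_cases ht : t ∈ Set.Ioc (0 : ℝ) 1
  · have : χ (0 - t) = 1 := by
      apply χ.one_of_mem_closedBall
      simp only [zero_sub, Metric.mem_closedBall, dist_zero_right, norm_neg, Real.norm_eq_abs]
      exact abs_le.2 ⟨by linarith [ht.1], ht.2⟩
    simp only [zero_sub] at this
    simp [ht, g, this]
  · simp [ht]

/-- Hadamard's lemma for families over the real line. -/
lemma SmoothFamily.exists_eq_add_smul_of_univ [IsManifold (𝓡 d) ∞ M] {p : ℝ → C^∞⟮𝓡 d, M; ℝ⟯}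
    (hp : SmoothFamily Set.univ p) :
    ∃ ψ : ℝ → C^∞⟮𝓡 d, M; ℝ⟯, SmoothFamily Set.univ ψ ∧ ∀ ε, p ε = p 0 + ε • ψ ε := by
  let ψ : ℝ × M → ℝ := fun z => ∫ s in (0 : ℝ)..1, deriv (fun τ => p τ z.2) (s * z.1)
  have hψ : ContMDiff (𝓘(ℝ, ℝ).prod (𝓡 d)) 𝓘(ℝ, ℝ) ∞ ψ := by
    intro z₀
    set φ := extChartAt (𝓡 d) z₀.2
    have hW : IsOpen φ.target := isOpen_extChartAt_target z₀.2
    have hb := hp.contDiffOn_chart z₀.2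
    set b := fun z : ℝ × EuclideanSpace ℝ (Fin d) => p z.1 (φ.symm z.2)
    have hO : IsOpen ((Set.univ : Set ℝ) ×ˢ φ.target) := isOpen_univ.prod hW
    have hb' : ContDiffOn ℝ ∞ (fun z => fderiv ℝ b z (1, 0)) (Set.univ ×ˢ φ.target) :=
      -- The time derivative is taken as the directional derivative along (1, 0), which makes it
      -- smooth jointly in time and the chart variable.
      (hb.fderiv_of_isOpen hO (m := ∞) le_rfl).clm_apply contDiffOn_const
    have hH := contDiffOn_integral_comp_mul hW hb'
    have hmem : (z₀.1, φ z₀.2) ∈ (Set.univ : Set ℝ) ×ˢ φ.target :=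
      ⟨trivial, mem_extChartAt_target z₀.2⟩
    have hH' := (hH.contDiffAt (hO.mem_nhds hmem)).contMDiffAt
    rw [modelWithCornersSelf_prod, ← chartedSpaceSelf_prod] at hH'
    have hc : ContMDiffAt (𝓘(ℝ, ℝ).prod (𝓡 d)) (𝓘(ℝ, ℝ).prod (𝓡 d)) ∞
        (fun z : ℝ × M => (z.1, φ z.2)) z₀ :=
      contMDiffAt_fst.prodMk (contMDiffAt_extChartAt.comp z₀ contMDiffAt_snd)
    refine (ContMDiffAt.comp z₀ hH' hc).congr_of_eventuallyEq ?_
    have : ∀ᶠ z : ℝ × M in nhds z₀, z.2 ∈ φ.source :=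
      continuous_snd.continuousAt.eventually (extChartAt_source_mem_nhds z₀.2)
    filter_upwards [this] with z hz
    refine intervalIntegral.integral_congr fun s _ => ?_
    have hd : HasFDerivAt b (fderiv ℝ b (s * z.1, φ z.2)) (s * z.1, φ z.2) :=
      ((hb.contDiffAt (hO.mem_nhds ⟨trivial, φ.map_source hz⟩)).differentiableAt
        (by simp)).hasFDerivAt
    have := hd.comp_hasDerivAt (f := fun τ : ℝ => (τ, φ z.2)) (s * z.1)
      ((hasDerivAt_id _).prodMk (hasDerivAt_const _ (φ z.2)))
    simpa [b, Function.comp_def, φ.left_inv hz] using this.deriv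
  refine ⟨fun ε => ⟨fun x => ψ (ε, x), hψ.comp (contMDiff_const.prodMk contMDiff_id)⟩,
    hψ.contMDiffOn, fun ε => ?_⟩
  ext x
  have hx : ContDiff ℝ ∞ (fun τ => p τ x) := contDiffOn_univ.1 (hp.contDiffOn_apply x)
  have := intervalIntegral.integral_unitInterval_deriv_eq_sub (z₀ := (0 : ℝ)) (z₁ := ε)
    (f := fun τ => p τ x) (f' := deriv fun τ => p τ x)
    ((hx.continuous_deriv (by simp)).comp (by fun_prop)).continuousOn
    (fun t _ => (hx.differentiable (by simp) _).hasDerivAt)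
  simp only [zero_add, smul_eq_mul] at this
  change p ε x = p 0 x + ε * ψ (ε, x)
  simp only [ψ]
  linarith

/-- Hadamard's lemma: near `t`, a smooth path is `p t + ε ψ ε` with a smooth path `ψ`. -/
lemma SmoothFamily.exists_eq_add_smul [IsManifold (𝓡 d) ∞ M] {p : ℝ → C^∞⟮𝓡 d, M; ℝ⟯}
    {O : Set ℝ} (hO : IsOpen O) (hp : SmoothFamily O p) {t : ℝ} (ht : t ∈ O) :
    ∃ ψ : ℝ → C^∞⟮𝓡 d, M; ℝ⟯, SmoothFamily Set.univ ψ ∧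
      ∀ᶠ ε in nhds (0 : ℝ), p (t + ε) = p t + ε • ψ ε := by
  obtain ⟨r, hr, hrO⟩ := Metric.isOpen_iff.1 hO t ht
  let χ : ContDiffBump (0 : ℝ) := ⟨r / 2, r, by positivity, by linarith⟩
  -- This reparametrization stays in O for every ε and equals t + ε near 0, which reduces to
  -- families over the whole line.
  let θ : ℝ → ℝ := fun ε => t + χ ε * ε
  have hθ : ContDiff ℝ ∞ θ := contDiff_const.add (χ.contDiff.mul contDiff_id)
  have hθO : Set.MapsTo θ Set.univ O := fun ε _ => by
    apply hrO
    simp only [θ, Metric.mem_ball, dist_self_add_left, Real.norm_eq_abs, abs_mul]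
    by_cases hε : |ε| < r
    · rw [abs_of_nonneg χ.nonneg]
      exact (mul_le_of_le_one_left (abs_nonneg _) χ.le_one).trans_lt hε
    · have : χ ε = 0 := χ.zero_of_le_dist (by simpa using hε)
      simpa [this] using hr
  obtain ⟨ψ, hψ, h⟩ := (hp.comp hθ.contDiffOn hθO).exists_eq_add_smul_of_univ
  refine ⟨ψ, hψ, ?_⟩
  filter_upwards [χ.eventuallyEq_one] with ε hε
  have := h ε
  simpa [θ, hε] using this

lemma HasPathDeriv.unique {f : ℝ → C^∞⟮𝓡 d, M; ℝ⟯} {g g' : C^∞⟮𝓡 d, M; ℝ⟯} {t : ℝ}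
    (h : HasPathDeriv f g t) (h' : HasPathDeriv f g' t) : g = g' := by
  ext x
  exact (h x).unique (h' x)

lemma HasPathDeriv.congr {f f' : ℝ → C^∞⟮𝓡 d, M; ℝ⟯} {g : C^∞⟮𝓡 d, M; ℝ⟯} {t : ℝ}
    (h : HasPathDeriv f g t) (h' : ∀ᶠ τ in nhds t, f' τ = f τ) : HasPathDeriv f' g t := fun x =>
  (h x).congr_of_eventuallyEq (h'.mono fun τ hτ => by simp only [hτ])

lemma HasPathDeriv.add {f f' : ℝ → C^∞⟮𝓡 d, M; ℝ⟯} {g g' : C^∞⟮𝓡 d, M; ℝ⟯} {t : ℝ}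
    (h : HasPathDeriv f g t) (h' : HasPathDeriv f' g' t) :
    HasPathDeriv (fun τ => f τ + f' τ) (g + g') t := fun x => (h x).add (h' x)

lemma HasPathDeriv.sub {f f' : ℝ → C^∞⟮𝓡 d, M; ℝ⟯} {g g' : C^∞⟮𝓡 d, M; ℝ⟯} {t : ℝ}
    (h : HasPathDeriv f g t) (h' : HasPathDeriv f' g' t) :
    HasPathDeriv (fun τ => f τ - f' τ) (g - g') t := fun x => (h x).sub (h' x)

lemma HasPathDeriv.const_smul {f : ℝ → C^∞⟮𝓡 d, M; ℝ⟯} {g : C^∞⟮𝓡 d, M; ℝ⟯} {t : ℝ} (c : ℝ)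
    (h : HasPathDeriv f g t) : HasPathDeriv (fun τ => c • f τ) (c • g) t :=
  fun x => (h x).const_smul c

lemma hasPathDeriv_const (f : C^∞⟮𝓡 d, M; ℝ⟯) (t : ℝ) : HasPathDeriv (fun _ => f) 0 t :=
  fun x => hasDerivAt_const t (f x)

lemma hasPathDeriv_add_smul (f φ : C^∞⟮𝓡 d, M; ℝ⟯) :
    HasPathDeriv (fun ε => f + ε • φ) φ 0 := fun x => by
  simpa using ((hasDerivAt_id (0 : ℝ)).mul_const (φ x)).const_add (f x)

/-- A smooth path has a derivative, which is the value at `0` of the difference quotient. -/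
lemma SmoothFamily.hasPathDeriv {p ψ : ℝ → C^∞⟮𝓡 d, M; ℝ⟯} (hψ : SmoothFamily Set.univ ψ) {t : ℝ}
    (h : ∀ᶠ ε in nhds (0 : ℝ), p (t + ε) = p t + ε • ψ ε) : HasPathDeriv p (ψ 0) t := fun x => by
  have hx : ContDiff ℝ ∞ (fun τ => ψ τ x) := contDiffOn_univ.1 (hψ.contDiffOn_apply x)
  have h1 : HasDerivAt (fun ε => p t x + ε * ψ ε x) (ψ 0 x) 0 := by
    simpa using ((hasDerivAt_id (0 : ℝ)).mul
      (hx.differentiable (by simp) 0).hasDerivAt).const_add (p t x)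
  have h2 : HasDerivAt (fun ε => p (t + ε) x) (ψ 0 x) 0 :=
    h1.congr_of_eventuallyEq (h.mono fun ε hε => by simp [hε])
  have h3 : HasDerivAt (fun τ => p (t + (-t + τ)) x) (ψ 0 x) t :=
    HasDerivAt.comp_const_add (f := fun ε => p (t + ε) x) (-t) t (by simpa using h2)
  simpa using h3

lemma SmoothFamily.exists_hasPathDeriv [IsManifold (𝓡 d) ∞ M] {p : ℝ → C^∞⟮𝓡 d, M; ℝ⟯}
    {O : Set ℝ} (hO : IsOpen O) (hp : SmoothFamily O p) {t : ℝ} (ht : t ∈ O) :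
    ∃ g, HasPathDeriv p g t := by
  obtain ⟨ψ, hψ, h⟩ := hp.exists_eq_add_smul hO ht
  exact ⟨ψ 0, hψ.hasPathDeriv h⟩

/-- Chain rule: a smooth map sends a smooth path with velocity `φ` to a path whose velocity is its
derivative in the direction `φ`. -/
lemma SmoothMapOn.hasPathDeriv_comp [IsManifold (𝓡 d) ∞ M] {U : Set C^∞⟮𝓡 d, M; ℝ⟯}
    {Φ : C^∞⟮𝓡 d, M; ℝ⟯ → C^∞⟮𝓡 d, M; ℝ⟯} (hΦ : SmoothMapOn U Φ) (hU : IsOpenSmooth U)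
    {c : ℝ → C^∞⟮𝓡 d, M; ℝ⟯} {O : Set ℝ} (hO : IsOpen O) (hc : SmoothFamily O c) {t : ℝ}
    (ht : t ∈ O) (hcU : c t ∈ U) {φ : C^∞⟮𝓡 d, M; ℝ⟯} (hφ : HasPathDeriv c φ t) :
    HasPathDeriv (fun τ => Φ (c τ)) (dirDeriv Φ (c t) φ) t := by
  obtain ⟨ψ, hψ, hcψ⟩ := hc.exists_eq_add_smul hO ht
  obtain rfl : ψ 0 = φ := (hψ.hasPathDeriv hcψ).unique hφ
  -- On the diagonal q is the curve itself, on the first axis it is the tangent line, on the second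
  -- it is constant. Linearity of the differential of Φ ∘ q at 0 then equates the derivatives along
  -- curve and line.
  let q : ℝ × ℝ → C^∞⟮𝓡 d, M; ℝ⟯ := fun v => c t + v.1 • ψ v.2
  have hq : SmoothFamily Set.univ q :=
    (smoothFamily_const _).add (SmoothFamily.smul contDiffOn_fst
      (hψ.comp contDiffOn_snd (Set.mapsTo_univ _ _)))
  let V : Set (ℝ × ℝ) := {v | v ∈ Set.univ ∧ q v ∈ U}
  have hV : IsOpen V := hU (ℝ × ℝ) Set.univ q isOpen_univ hq
  have h0 : (0 : ℝ × ℝ) ∈ V := ⟨trivial, by simpa [q] using hcU⟩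
  have hu : SmoothFamily V (fun v => Φ (q v)) :=
    hΦ (ℝ × ℝ) V q hV (hq.mono (Set.subset_univ _)) fun v hv => hv.2
  have hline : ∃ g, HasPathDeriv (fun ε : ℝ => Φ (c t + ε • ψ 0)) g 0 := by
    have hθ : ContDiff ℝ ∞ (fun ε : ℝ => (ε, (0 : ℝ))) := by fun_prop
    exact (hu.comp (O' := (fun ε : ℝ => (ε, (0 : ℝ))) ⁻¹' V)
      hθ.contDiffOn fun _ h => h).exists_hasPathDeriv (hV.preimage hθ.continuous) (t := 0) h0
  have hdir : HasPathDeriv (fun ε : ℝ => Φ (c t + ε • ψ 0)) (dirDeriv Φ (c t) (ψ 0)) 0 := by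
    rw [dirDeriv, dif_pos hline]
    exact hline.choose_spec
  intro x
  have hd : HasFDerivAt (fun v => Φ (q v) x) (fderiv ℝ (fun v => Φ (q v) x) 0) 0 :=
    (((hu.contDiffOn_apply x).contDiffAt (hV.mem_nhds h0)).differentiableAt
      (by simp)).hasFDerivAt
  set L := fderiv ℝ (fun v => Φ (q v) x) 0
  have h1 : HasDerivAt (fun ε : ℝ => Φ (q (ε, 0)) x) (L (1, 0)) 0 :=
    hd.comp_hasDerivAt (f := fun ε : ℝ => (ε, (0 : ℝ))) 0
      ((hasDerivAt_id _).prodMk (hasDerivAt_const _ _))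
  have h2 : HasDerivAt (fun ε : ℝ => Φ (q (0, ε)) x) (L (0, 1)) 0 :=
    hd.comp_hasDerivAt (f := fun ε : ℝ => ((0 : ℝ), ε)) 0
      ((hasDerivAt_const _ _).prodMk (hasDerivAt_id _))
  have h3 : HasDerivAt (fun ε : ℝ => Φ (q (ε, ε)) x) (L (1, 1)) 0 :=
    hd.comp_hasDerivAt (f := fun ε : ℝ => (ε, ε)) 0 ((hasDerivAt_id _).prodMk (hasDerivAt_id _))
  have e1 : L (1, 0) = dirDeriv Φ (c t) (ψ 0) x := h1.unique (hdir x)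
  have e2 : L (0, 1) = 0 := h2.unique (by simpa [q] using hasDerivAt_const (0 : ℝ) (Φ (c t) x))
  have e3 : L (1, 1) = dirDeriv Φ (c t) (ψ 0) x := by
    have := L.map_add (1, 0) (0, 1)
    rw [e1, e2, Prod.mk_add_mk, add_zero, add_zero, zero_add] at this
    exact this
  rw [e3] at h3
  have h4 : HasDerivAt (fun ε => Φ (c (t + ε)) x) (dirDeriv Φ (c t) (ψ 0) x) 0 :=
    h3.congr_of_eventuallyEq (hcψ.mono fun ε hε => by simp only [hε, q])
  have h5 : HasDerivAt (fun τ => Φ (c (t + (-t + τ))) x) (dirDeriv Φ (c t) (ψ 0) x) t :=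
    HasDerivAt.comp_const_add (f := fun ε => Φ (c (t + ε)) x) (-t) t (by simpa using h4)
  simpa using h5

lemma smoothFamily_add_smul (f φ : C^∞⟮𝓡 d, M; ℝ⟯) :
    SmoothFamily (Set.univ : Set ℝ) (fun ε => f + ε • φ) :=
  (smoothFamily_const f).add (SmoothFamily.smul contDiffOn_id (smoothFamily_const φ))

/-- The parameters for which a line stays in an open set form an open set. -/
lemma IsOpenSmooth.isOpen_preimage_line {V : Set C^∞⟮𝓡 d, M; ℝ⟯} (hV : IsOpenSmooth V)
    (f φ : C^∞⟮𝓡 d, M; ℝ⟯) : IsOpen {ε : ℝ | f + ε • φ ∈ V} := by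
  simpa using hV ℝ Set.univ _ isOpen_univ (smoothFamily_add_smul f φ)

lemma SmoothMapOn.hasPathDeriv_add_smul [IsManifold (𝓡 d) ∞ M] {U : Set C^∞⟮𝓡 d, M; ℝ⟯}
    {Φ : C^∞⟮𝓡 d, M; ℝ⟯ → C^∞⟮𝓡 d, M; ℝ⟯} (hΦ : SmoothMapOn U Φ) (hU : IsOpenSmooth U)
    {f : C^∞⟮𝓡 d, M; ℝ⟯} (hf : f ∈ U) (φ : C^∞⟮𝓡 d, M; ℝ⟯) :
    HasPathDeriv (fun ε : ℝ => Φ (f + ε • φ)) (dirDeriv Φ f φ) 0 := by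
  simpa using hΦ.hasPathDeriv_comp hU isOpen_univ (smoothFamily_add_smul f φ) (t := 0) trivial
    (by simpa using hf) (HopfCole.hasPathDeriv_add_smul f φ)

lemma SmoothMapOn.dirDeriv_smul [IsManifold (𝓡 d) ∞ M] {U : Set C^∞⟮𝓡 d, M; ℝ⟯}
    {Φ : C^∞⟮𝓡 d, M; ℝ⟯ → C^∞⟮𝓡 d, M; ℝ⟯} (hΦ : SmoothMapOn U Φ) (hU : IsOpenSmooth U)
    {f : C^∞⟮𝓡 d, M; ℝ⟯} (hf : f ∈ U) (a : ℝ) (φ : C^∞⟮𝓡 d, M; ℝ⟯) :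
    dirDeriv Φ f (a • φ) = a • dirDeriv Φ f φ := by
  refine (hΦ.hasPathDeriv_add_smul hU hf (a • φ)).unique fun x => ?_
  have h := hΦ.hasPathDeriv_add_smul hU hf φ x
  have h1 : HasDerivAt (fun ε : ℝ => ε * a) a 0 := by
    simpa using (hasDerivAt_id (0 : ℝ)).mul_const a
  have := HasDerivAt.comp (h := fun ε : ℝ => ε * a) 0 (by simpa using h) h1
  simpa [Function.comp_def, smul_smul, mul_comm] using this

/-- The three directional derivatives are values of a single differential, that of (s, r) ↦ Φ(f + sφ
+ rψ) at the origin. -/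
lemma SmoothMapOn.dirDeriv_add [IsManifold (𝓡 d) ∞ M] {U : Set C^∞⟮𝓡 d, M; ℝ⟯}
    {Φ : C^∞⟮𝓡 d, M; ℝ⟯ → C^∞⟮𝓡 d, M; ℝ⟯} (hΦ : SmoothMapOn U Φ) (hU : IsOpenSmooth U)
    {f : C^∞⟮𝓡 d, M; ℝ⟯} (hf : f ∈ U) (φ ψ : C^∞⟮𝓡 d, M; ℝ⟯) :
    dirDeriv Φ f (φ + ψ) = dirDeriv Φ f φ + dirDeriv Φ f ψ := by
  let q : ℝ × ℝ → C^∞⟮𝓡 d, M; ℝ⟯ := fun v => f + v.1 • φ + v.2 • ψ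
  have hq : SmoothFamily Set.univ q :=
    ((smoothFamily_const _).add (SmoothFamily.smul contDiffOn_fst (smoothFamily_const _))).add
      (SmoothFamily.smul contDiffOn_snd (smoothFamily_const _))
  let V : Set (ℝ × ℝ) := {v | v ∈ Set.univ ∧ q v ∈ U}
  have hV : IsOpen V := hU (ℝ × ℝ) Set.univ q isOpen_univ hq
  have h0 : (0 : ℝ × ℝ) ∈ V := ⟨trivial, by simpa [q] using hf⟩
  have hu : SmoothFamily V (fun v => Φ (q v)) :=
    hΦ (ℝ × ℝ) V q hV (hq.mono (Set.subset_univ _)) fun v hv => hv.2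
  ext x
  have hd : HasFDerivAt (fun v => Φ (q v) x) (fderiv ℝ (fun v => Φ (q v) x) 0) 0 :=
    (((hu.contDiffOn_apply x).contDiffAt (hV.mem_nhds h0)).differentiableAt
      (by simp)).hasFDerivAt
  set L := fderiv ℝ (fun v => Φ (q v) x) 0
  have h1 : HasDerivAt (fun ε : ℝ => Φ (q (ε, 0)) x) (L (1, 0)) 0 :=
    hd.comp_hasDerivAt (f := fun ε : ℝ => (ε, (0 : ℝ))) 0
      ((hasDerivAt_id _).prodMk (hasDerivAt_const _ _))
  have h2 : HasDerivAt (fun ε : ℝ => Φ (q (0, ε)) x) (L (0, 1)) 0 :=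
    hd.comp_hasDerivAt (f := fun ε : ℝ => ((0 : ℝ), ε)) 0
      ((hasDerivAt_const _ _).prodMk (hasDerivAt_id _))
  have h3 : HasDerivAt (fun ε : ℝ => Φ (q (ε, ε)) x) (L (1, 1)) 0 :=
    hd.comp_hasDerivAt (f := fun ε : ℝ => (ε, ε)) 0 ((hasDerivAt_id _).prodMk (hasDerivAt_id _))
  have e1 : dirDeriv Φ f φ x = L (1, 0) :=
    (hΦ.hasPathDeriv_add_smul hU hf φ x).unique (by simpa [q] using h1)
  have e2 : dirDeriv Φ f ψ x = L (0, 1) :=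
    (hΦ.hasPathDeriv_add_smul hU hf ψ x).unique (by simpa [q] using h2)
  have e3 : dirDeriv Φ f (φ + ψ) x = L (1, 1) :=
    (hΦ.hasPathDeriv_add_smul hU hf (φ + ψ) x).unique (by simpa [q, add_assoc] using h3)
  change _ = dirDeriv Φ f φ x + dirDeriv Φ f ψ x
  rw [e1, e2, e3, ← map_add]
  simp

end SmoothFamilies

/-! ### Local finiteness of the Riemannian volume. -/

section Volume

variable {d : ℕ} {M : Type*} [EMetricSpace M]
    [ChartedSpace (EuclideanSpace ℝ (Fin d)) M] [IsManifold (𝓡 d) 1 M]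
    [RiemannianBundle (fun x : M => TangentSpace (𝓡 d) x)]
    [IsContinuousRiemannianBundle (EuclideanSpace ℝ (Fin d))
      (fun x : M => TangentSpace (𝓡 d) x)]

open Metric Set Topology
open scoped NNReal ENNReal

/-- The differential of the inverse chart is the inverse of the tangent bundle trivialization, whose
norm is locally bounded because the metric is continuous. -/
lemma exists_enorm_mfderivWithin_extChartAt_symm_le (x : M) :
    ∃ C : ℝ≥0, ∀ᶠ y in 𝓝 (extChartAt (𝓡 d) x x), ∀ w : EuclideanSpace ℝ (Fin d),
      ‖mfderivWithin (𝓡 d) (𝓡 d) (extChartAt (𝓡 d) x).symm (range (𝓡 d)) y w‖ₑ ≤ C * ‖w‖ₑ := by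
  rcases eventually_norm_symmL_trivializationAt_lt (EuclideanSpace ℝ (Fin d))
    (fun x : M => TangentSpace (𝓡 d) x) x with ⟨C, C_pos, hC⟩
  lift C to ℝ≥0 using C_pos.le
  refine ⟨C, ?_⟩
  have hcont : Filter.Tendsto (extChartAt (𝓡 d) x).symm (𝓝 (extChartAt (𝓡 d) x x)) (𝓝 x) := by
    simpa using (continuousAt_extChartAt_symm (I := 𝓡 d) x).tendsto
  filter_upwards [hcont.eventually hC, hcont.eventually 
      (chart_source_mem_nhds (EuclideanSpace ℝ (Fin d)) x),
    extChartAt_target_mem_nhds (I := 𝓡 d) x] with y hy hy' hyt w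
  have h1 := TangentBundle.symmL_trivializationAt (I := 𝓡 d) hy'
  rw [(extChartAt (𝓡 d) x).right_inv hyt] at h1
  have h2 := ContinuousLinearMap.le_of_opNorm_le _ hy.le w
  rw [h1] at h2
  have h3 : ENNReal.ofReal (C * ‖w‖) = C * ‖w‖ₑ := by
    rw [ENNReal.ofReal_mul C.coe_nonneg, ENNReal.ofReal_coe_nnreal, ofReal_norm]
  exact (ofReal_norm _).symm.trans_le ((ENNReal.ofReal_le_ofReal h2).trans_eq h3)

/-- Around any point, the inverse of the extended chart is Lipschitz for the Riemannian distance. -/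
lemma exists_lipschitzOnWith_extChartAt_symm [IsRiemannianManifold (𝓡 d) M] (x : M) :
    ∃ C : ℝ≥0, ∃ r > 0, ball (extChartAt (𝓡 d) x x) r ⊆ (extChartAt (𝓡 d) x).target ∧
      LipschitzOnWith C (extChartAt (𝓡 d) x).symm (ball (extChartAt (𝓡 d) x x) r) := by
  rcases exists_enorm_mfderivWithin_extChartAt_symm_le (d := d) x with ⟨C, hC⟩
  obtain ⟨r, r_pos, hr⟩ := Metric.mem_nhds_iff.1
    (Filter.inter_mem (extChartAt_target_mem_nhds (I := 𝓡 d) x) hC)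
  refine ⟨C, r, r_pos, hr.trans inter_subset_left, fun y hy z hz => ?_⟩
  rw [IsRiemannianManifold.out (I := 𝓡 d)]
  -- The image of the segment from y to z bounds the Riemannian distance by its length, and its
  -- speed is at most C times the Euclidean one. The segment stays in the ball by convexity.
  let η := ContinuousAffineMap.lineMap (R := ℝ) y z
  set γ := (extChartAt (𝓡 d) x).symm ∘ η
  have hη : ∀ t ∈ Icc (0 : ℝ) 1, η t ∈ ball (extChartAt (𝓡 d) x x) r := by
    intro t ht
    apply (convex_ball _ _).segment_subset hy hz
    rw [segment_eq_image_lineMap]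
    exact ⟨t, ht, rfl⟩
  have η_smooth : ContMDiffOn 𝓘(ℝ, ℝ) (𝓡 d) 1 η (Icc 0 1) := by
    apply ContMDiff.contMDiffOn
    rw [contMDiff_iff_contDiff]
    exact ContinuousAffineMap.contDiff _
  have : riemannianEDist (𝓡 d) ((extChartAt (𝓡 d) x).symm y) ((extChartAt (𝓡 d) x).symm z)
      ≤ pathELength (𝓡 d) γ 0 1 := by
    apply riemannianEDist_le_pathELength _ _ _ zero_le_one
    · exact (contMDiffOn_extChartAt_symm x).comp η_smooth fun t ht => (hr (hη t ht)).1
    · simp [γ, η, ContinuousAffineMap.coe_lineMap_eq]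
    · simp [γ, η, ContinuousAffineMap.coe_lineMap_eq]
  apply this.trans
  rw [← lintegral_fderiv_lineMap_eq_edist, pathELength_eq_lintegral_mfderivWithin_Icc,
    ← lintegral_const_mul' _ _ ENNReal.coe_ne_top]
  apply setLIntegral_mono' measurableSet_Icc (fun t ht ↦ ?_)
  have : mfderivWithin 𝓘(ℝ, ℝ) (𝓡 d) γ (Icc 0 1) t =
      (mfderivWithin (𝓡 d) (𝓡 d) (extChartAt (𝓡 d) x).symm (range (𝓡 d)) (η t)) ∘L
        (mfderivWithin 𝓘(ℝ, ℝ) (𝓡 d) η (Icc 0 1) t) := by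
    apply mfderivWithin_comp
    · exact mdifferentiableWithinAt_extChartAt_symm (hr (hη t ht)).1
    · exact η_smooth.mdifferentiableOn one_ne_zero t ht
    · exact fun t _ => by simp
    · rw [uniqueMDiffWithinAt_iff_uniqueDiffWithinAt]
      exact uniqueDiffOn_Icc zero_lt_one t ht
  have : mfderivWithin 𝓘(ℝ, ℝ) (𝓡 d) γ (Icc 0 1) t 1 =
      (mfderivWithin (𝓡 d) (𝓡 d) (extChartAt (𝓡 d) x).symm (range (𝓡 d)) (η t))
        (mfderivWithin 𝓘(ℝ, ℝ) (𝓡 d) η (Icc 0 1) t 1) :=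
    DFunLike.congr_fun this 1
  rw [this]
  refine ((hr (hη t ht)).2 _).trans (le_of_eq ?_)
  simp only [mfderivWithin_eq_fderivWithin]
  rfl

/-- A Lipschitz image of a Euclidean ball has finite d-dimensional Hausdorff measure, and such
images are neighbourhoods in M. -/
lemma isLocallyFiniteMeasure_vol [MeasurableSpace M] [BorelSpace M]
    [IsRiemannianManifold (𝓡 d) M] : IsLocallyFiniteMeasure (vol d M) where
  finiteAtNhds x := by
    obtain ⟨C, r, hr, hsub, hC⟩ := exists_lipschitzOnWith_extChartAt_symm (d := d) x
    set φ := extChartAt (𝓡 d) x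
    refine ⟨φ.symm '' ball (φ x) r, ?_, ?_⟩
    · have h1 : φ ⁻¹' ball (φ x) r ∈ 𝓝 x :=
        (continuousAt_extChartAt (I := 𝓡 d) x).preimage_mem_nhds (ball_mem_nhds _ hr)
      filter_upwards [h1, extChartAt_source_mem_nhds (I := 𝓡 d) x] with y hy hy'
      exact ⟨φ y, hy, φ.left_inv hy'⟩
    · have h1 := hC.hausdorffMeasure_image_le (Nat.cast_nonneg d)
      have h2 : (μH[(d : ℝ)] : Measure (EuclideanSpace ℝ (Fin d))) (ball (φ x) r) < ⊤ :=
        measure_ball_lt_top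
      have h3 : (μH[(d : ℝ)] : Measure M) (φ.symm '' ball (φ x) r) < ⊤ :=
        h1.trans_lt (ENNReal.mul_lt_top (by simp) h2)
      rw [vol, Measure.euclideanHausdorffMeasure_def, Measure.smul_apply]
      exact ENNReal.mul_lt_top (by simp) h3

end Volume

/-! ### Gradients in charts and joint continuity of their inner products. -/

section Gradient

variable {d : ℕ} {M : Type*} [EMetricSpace M]
  [ChartedSpace (EuclideanSpace ℝ (Fin d)) M]
  {P : Type*} [NormedAddCommGroup P] [NormedSpace ℝ P] {O : Set P} {A B : P → C^∞⟮𝓡 d, M; ℝ⟯}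

lemma inner_grad [RiemannianBundle (fun x : M => TangentSpace (𝓡 d) x)]
    (f : C^∞⟮𝓡 d, M; ℝ⟯) (x : M) (v : TangentSpace (𝓡 d) x) :
    inner ℝ (grad f x) v = mvfderiv (𝓡 d) f x v := by
  rw [grad, InnerProductSpace.toDual_symm_apply]

variable [IsManifold (𝓡 d) ∞ M]

/-- The differential of `f`, read in the trivialization of the tangent bundle at `x₀`. -/
lemma mvfderiv_symmL_trivializationAt (f : C^∞⟮𝓡 d, M; ℝ⟯) {x₀ x : M}
    (hx : x ∈ (chartAt (EuclideanSpace ℝ (Fin d)) x₀).source) (w : EuclideanSpace ℝ (Fin d)) :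
    mvfderiv (𝓡 d) f x ((trivializationAt (EuclideanSpace ℝ (Fin d))
      (fun x : M => TangentSpace (𝓡 d) x) x₀).symmL ℝ x w) =
      fderiv ℝ (fun y => f ((extChartAt (𝓡 d) x₀).symm y)) (extChartAt (𝓡 d) x₀ x) w := by
  have hx' : x ∈ (extChartAt (𝓡 d) x₀).source := by simpa using hx
  have h1 := TangentBundle.symmL_trivializationAt (I := 𝓡 d) hx
  have hinv : (extChartAt (𝓡 d) x₀).symm (extChartAt (𝓡 d) x₀ x) = x :=
    (extChartAt (𝓡 d) x₀).left_inv hx'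
  have h2 : MDifferentiableAt (𝓡 d) (𝓡 d) (extChartAt (𝓡 d) x₀).symm (extChartAt (𝓡 d) x₀ x) :=
    ((contMDiffOn_extChartAt_symm (n := ∞) x₀).contMDiffAt
      ((isOpen_extChartAt_target x₀).mem_nhds
        ((extChartAt (𝓡 d) x₀).map_source hx'))).mdifferentiableAt (by simp)
  have h3 : MDifferentiableAt (𝓡 d) 𝓘(ℝ, ℝ) f
      ((extChartAt (𝓡 d) x₀).symm (extChartAt (𝓡 d) x₀ x)) :=
    f.contMDiff.contMDiffAt.mdifferentiableAt (by simp)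
  have h4 := mfderiv_comp (extChartAt (𝓡 d) x₀ x) h3 h2
  rw [h1, ModelWithCorners.range_eq_univ, mfderivWithin_univ]
  rw [← mfderiv_eq_fderiv]
  change _ = mfderiv (𝓡 d) 𝓘(ℝ, ℝ) (f ∘ (extChartAt (𝓡 d) x₀).symm) (extChartAt (𝓡 d) x₀ x) w
  rw [h4, hinv]
  rfl

lemma SmoothFamily.continuousAt_fderiv_chart (hO : IsOpen O) (hA : SmoothFamily O A) {v₀ : P}
    (hv : v₀ ∈ O) (x₀ : M) :
    ContinuousAt (fun z : P × M => fderiv ℝ (fun y => A z.1 ((extChartAt (𝓡 d) x₀).symm y))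
      (extChartAt (𝓡 d) x₀ z.2)) (v₀, x₀) := by
  set φ := extChartAt (𝓡 d) x₀
  let a := fun z : P × EuclideanSpace ℝ (Fin d) => A z.1 (φ.symm z.2)
  have ha : ContDiffOn ℝ ∞ a (O ×ˢ φ.target) := hA.contDiffOn_chart x₀
  have hopen : IsOpen (O ×ˢ φ.target) := hO.prod (isOpen_extChartAt_target x₀)
  have h1 : ContinuousAt (fun z => (fderiv ℝ a z).comp
      (ContinuousLinearMap.inr ℝ P (EuclideanSpace ℝ (Fin d)))) (v₀, φ x₀) :=
    ((ha.continuousOn_fderiv_of_isOpen hopen (by simp)).continuousAt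
      (hopen.mem_nhds ⟨hv, mem_extChartAt_target x₀⟩)).clm_comp continuousAt_const
  have h2 : ContinuousAt (fun z : P × M => (z.1, φ z.2)) (v₀, x₀) :=
    continuousAt_fst.prodMk (ContinuousAt.comp (f := Prod.snd)
      (continuousAt_extChartAt (I := 𝓡 d) x₀) continuousAt_snd)
  refine (ContinuousAt.comp (f := fun z : P × M => (z.1, φ z.2)) h1 h2).congr ?_
  have h3 : ∀ᶠ z : P × M in nhds (v₀, x₀), z.2 ∈ φ.source :=
    continuousAt_snd.eventually (extChartAt_source_mem_nhds x₀)
  filter_upwards [h3, continuousAt_fst.eventually (hO.mem_nhds hv)] with z hz hzO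
  have hd : HasFDerivAt a (fderiv ℝ a (z.1, φ z.2)) (z.1, φ z.2) :=
    ((ha.contDiffAt (hopen.mem_nhds ⟨show z.1 ∈ O from hzO, φ.map_source hz⟩)).differentiableAt
      (by simp)).hasFDerivAt
  -- The derivative in the chart variable alone is the full derivative restricted to the second
  -- factor, hence continuous in the parameter too.
  exact (hd.comp (φ z.2) (hasFDerivAt_prodMk_right z.1 (φ z.2))).fderiv.symm

variable [RiemannianBundle (fun x : M => TangentSpace (𝓡 d) x)]

/-- The Riemannian metric at `x`, read in the trivialization of the tangent bundle at `x₀`. -/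
def gram (x₀ x : M) :
    EuclideanSpace ℝ (Fin d) →L[ℝ] EuclideanSpace ℝ (Fin d) →L[ℝ] ℝ :=
  let L := (trivializationAt (EuclideanSpace ℝ (Fin d))
      (fun x : M => TangentSpace (𝓡 d) x) x₀).symmL ℝ x
  (innerSL ℝ (E := TangentSpace (𝓡 d) x)).bilinearComp L L

lemma gram_apply (x₀ x : M) (u w : EuclideanSpace ℝ (Fin d)) :
    gram x₀ x u w = inner ℝ ((trivializationAt (EuclideanSpace ℝ (Fin d))
      (fun x : M => TangentSpace (𝓡 d) x) x₀).symmL ℝ x u) ((trivializationAt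
        (EuclideanSpace ℝ (Fin d)) (fun x : M => TangentSpace (𝓡 d) x) x₀).symmL ℝ x w) := by
  rfl

lemma continuousOn_gram [IsContinuousRiemannianBundle (EuclideanSpace ℝ (Fin d))
      (fun x : M => TangentSpace (𝓡 d) x)]
    (x₀ : M) :
    ContinuousOn (gram (d := d) x₀) (chartAt (EuclideanSpace ℝ (Fin d)) x₀).source := by
  have key : ∀ u : EuclideanSpace ℝ (Fin d), ContinuousOn (fun x : M =>
      (TotalSpace.mk' (EuclideanSpace ℝ (Fin d)) (E := fun x : M => TangentSpace (𝓡 d) x) x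
        ((trivializationAt (EuclideanSpace ℝ (Fin d))
          (fun x : M => TangentSpace (𝓡 d) x) x₀).symmL ℝ x u)))
      (chartAt (EuclideanSpace ℝ (Fin d)) x₀).source := fun u => by
    refine ((trivializationAt (EuclideanSpace ℝ (Fin d)) (fun x : M => TangentSpace (𝓡 d) x)
      x₀).continuousOn_symm_prodMk_left (v := u)).congr fun x hx => ?_
    rw [Trivialization.symmL_apply _ hx]
    exact Trivialization.mk_symm _ hx u
  refine continuousOn_clm_apply.2 fun u => continuousOn_clm_apply.2 fun w => ?_
  simp only [gram_apply]
  exact (key u).inner_bundle (key w)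

/-- Definiteness of the inner product gives injectivity; equality of dimensions does the rest. -/
lemma isInvertible_gram {x₀ x : M}
    (hx : x ∈ (chartAt (EuclideanSpace ℝ (Fin d)) x₀).source) :
    (gram (d := d) x₀ x).IsInvertible := by
  have hinj : Function.Injective (gram (d := d) x₀ x) := by
    rw [injective_iff_map_eq_zero]
    intro u hu
    have h := gram_apply x₀ x u u
    rw [hu] at h
    have h' := inner_self_eq_zero.1 h.symm
    have := Trivialization.continuousLinearMapAt_symmL (R := ℝ)
      (trivializationAt (EuclideanSpace ℝ (Fin d)) (fun x : M => TangentSpace (𝓡 d) x) x₀)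
      (b := x) (by simpa using hx) u
    rw [h', map_zero] at this
    exact this.symm
  have hdim : Module.finrank ℝ (EuclideanSpace ℝ (Fin d)) =
      Module.finrank ℝ (EuclideanSpace ℝ (Fin d) →L[ℝ] ℝ) := by
    rw [← (LinearMap.toContinuousLinearMap (𝕜 := ℝ) (E := EuclideanSpace ℝ (Fin d))
      (F' := ℝ)).finrank_eq]
    exact (Subspace.dual_finrank_eq (K := ℝ)).symm
  exact ⟨(LinearMap.linearEquivOfInjective (gram (d := d) x₀ x).toLinearMap
    hinj hdim).toContinuousLinearEquiv, by ext; rfl⟩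

/-- The inner product of two gradients, read in a chart. -/
lemma inner_grad_grad_eq (f g : C^∞⟮𝓡 d, M; ℝ⟯) {x₀ x : M}
    (hx : x ∈ (chartAt (EuclideanSpace ℝ (Fin d)) x₀).source) :
    inner ℝ (grad f x) (grad g x) =
      fderiv ℝ (fun y => f ((extChartAt (𝓡 d) x₀).symm y)) (extChartAt (𝓡 d) x₀ x)
        ((gram x₀ x).inverse
          (fderiv ℝ (fun y => g ((extChartAt (𝓡 d) x₀).symm y)) (extChartAt (𝓡 d) x₀ x))) := by
  set e := trivializationAt (EuclideanSpace ℝ (Fin d)) (fun x : M => TangentSpace (𝓡 d) x) x₀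
  set u : EuclideanSpace ℝ (Fin d) := e.continuousLinearMapAt ℝ x (grad g x)
  have hu : e.symmL ℝ x u = grad g x :=
    e.symmL_continuousLinearMapAt (R := ℝ) (by simpa [e] using hx) _
  have hG : gram x₀ x u =
      fderiv ℝ (fun y => g ((extChartAt (𝓡 d) x₀).symm y)) (extChartAt (𝓡 d) x₀ x) := by
    ext w
    rw [gram_apply, hu, inner_grad, mvfderiv_symmL_trivializationAt g hx]
  have hG' := (isInvertible_gram hx).inverse_apply_eq.2 hG.symm
  rw [hG', inner_grad, ← hu, mvfderiv_symmL_trivializationAt f hx]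

/-- The inner product of the gradients of two smooth families is jointly continuous. -/
lemma SmoothFamily.continuousOn_inner_grad
    [IsContinuousRiemannianBundle (EuclideanSpace ℝ (Fin d))
      (fun x : M => TangentSpace (𝓡 d) x)]
    (hO : IsOpen O) (hA : SmoothFamily O A)
    (hB : SmoothFamily O B) :
    ContinuousOn (fun z : P × M => inner ℝ (grad (A z.1) z.2) (grad (B z.1) z.2))
      (O ×ˢ Set.univ) := by
  rintro ⟨v₀, x₀⟩ ⟨hv, -⟩
  apply ContinuousAt.continuousWithinAt
  have hsrc := chart_source_mem_nhds (EuclideanSpace ℝ (Fin d)) x₀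
  have h1 : ContinuousAt (fun z : P × M => (gram (d := d) x₀ z.2).inverse) (v₀, x₀) := by
    have h2 : ContinuousAt (fun z : P × M => gram (d := d) x₀ z.2) (v₀, x₀) :=
      ContinuousAt.comp (f := Prod.snd) ((continuousOn_gram x₀).continuousAt hsrc) continuousAt_snd
    -- Inversion of operators is continuous at an invertible one, so the inverse metric is
    -- continuous in the chart.
    have h3 : ContinuousAt ContinuousLinearMap.inverse (gram (d := d) x₀ x₀) :=
      ((isInvertible_gram (mem_chart_source (EuclideanSpace ℝ (Fin d)) x₀)).contDiffAt_map_inverse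
        (n := 0)).continuousAt
    exact ContinuousAt.comp (f := fun z : P × M => gram (d := d) x₀ z.2) (x := (v₀, x₀)) h3 h2
  refine ((hA.continuousAt_fderiv_chart hO hv x₀).clm_apply
    (h1.clm_apply (hB.continuousAt_fderiv_chart hO hv x₀))).congr ?_
  filter_upwards [continuousAt_snd.eventually hsrc] with z hz
  exact (inner_grad_grad_eq _ _ hz).symm

end Gradient

/-- Continuity of c suffices, so after Hadamard's lemma integrals can be differentiated using only
continuity of the integrated difference quotient. -/
lemma hasDerivAt_mul_of_continuousAt {c : ℝ → ℝ} (hc : ContinuousAt c 0) :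
    HasDerivAt (fun ε => ε * c ε) (c 0) 0 := by
  rw [hasDerivAt_iff_tendsto_slope_zero]
  refine (hc.tendsto.mono_left nhdsWithin_le_nhds).congr' ?_
  filter_upwards [self_mem_nhdsWithin] with t ht
  have : t ≠ 0 := ht
  simp [this]

/-! ### Linearity and continuity of the pairing and the gradient. -/

section Algebra

variable {d : ℕ} {M : Type*} [EMetricSpace M] [ChartedSpace (EuclideanSpace ℝ (Fin d)) M]

lemma SmoothFamily.continuous_uncurry {ψ : ℝ → C^∞⟮𝓡 d, M; ℝ⟯} (hψ : SmoothFamily Set.univ ψ) :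
    Continuous (fun z : ℝ × M => ψ z.1 z.2) := by
  have := ContMDiffOn.continuousOn hψ
  rwa [Set.univ_prod_univ, continuousOn_univ] at this

lemma continuous_pairing_integrand (f g : C^∞⟮𝓡 d, M; ℝ⟯) : Continuous (fun x => f x * g x) :=
  f.contMDiff.continuous.mul g.contMDiff.continuous

section Pairing

variable [MeasurableSpace M] [BorelSpace M]

lemma pairing_comm (f g : C^∞⟮𝓡 d, M; ℝ⟯) : pairing f g = pairing g f := by
  simp only [pairing, mul_comm]

lemma pairing_smul_left (a : ℝ) (f h : C^∞⟮𝓡 d, M; ℝ⟯) :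
    pairing (a • f) h = a * pairing f h := by
  rw [pairing, pairing, ← integral_const_mul]
  simp [mul_assoc]

end Pairing

variable [RiemannianBundle (fun x : M => TangentSpace (𝓡 d) x)]

lemma grad_add (f g : C^∞⟮𝓡 d, M; ℝ⟯) (x : M) : grad (f + g) x = grad f x + grad g x := by
  have hf : MDifferentiableAt (𝓡 d) 𝓘(ℝ, ℝ) f x :=
    f.contMDiff.contMDiffAt.mdifferentiableAt (by simp)
  have hg : MDifferentiableAt (𝓡 d) 𝓘(ℝ, ℝ) g x :=
    g.contMDiff.contMDiffAt.mdifferentiableAt (by simp)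
  rw [grad, ContMDiffMap.coe_add, mvfderiv_add hf hg, map_add]
  rfl

lemma grad_smul (a : ℝ) (f : C^∞⟮𝓡 d, M; ℝ⟯) (x : M) : grad (a • f) x = a • grad f x := by
  have hf : MDifferentiableAt (𝓡 d) 𝓘(ℝ, ℝ) f x :=
    f.contMDiff.contMDiffAt.mdifferentiableAt (by simp)
  have h : mvfderiv (𝓡 d) (a • f) x = a • mvfderiv (𝓡 d) f x := by
    have := mvfderiv_smul (I := 𝓡 d) (a := fun _ : M => a) mdifferentiableAt_const hf
    rw [mvfderiv_const, ContinuousLinearMap.zero_smulRight, add_zero] at this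
    exact this
  refine ext_inner_right ℝ fun v => ?_
  rw [inner_grad, inner_smul_left, inner_grad, h]
  rfl

lemma grad_zero (x : M) : grad (0 : C^∞⟮𝓡 d, M; ℝ⟯) x = 0 := by
  simpa using grad_smul 0 (0 : C^∞⟮𝓡 d, M; ℝ⟯) x

/-- The derivative of `(A, C) ↦ ∫ |∇A|² C dx` in the direction `(A', C')`. -/
def energyDeriv [MeasurableSpace M] [BorelSpace M] (A C A' C' : C^∞⟮𝓡 d, M; ℝ⟯) : ℝ :=
  ∫ x, (2 * inner ℝ (grad A x) (grad A' x) * C x + ‖grad A x‖ ^ 2 * C' x) ∂(vol d M)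

variable [IsManifold (𝓡 d) ∞ M]
  [IsContinuousRiemannianBundle (EuclideanSpace ℝ (Fin d)) (fun x : M => TangentSpace (𝓡 d) x)]

lemma SmoothFamily.continuous_inner_grad {A B : ℝ → C^∞⟮𝓡 d, M; ℝ⟯}
    (hA : SmoothFamily Set.univ A) (hB : SmoothFamily Set.univ B) :
    Continuous (fun z : ℝ × M => inner ℝ (grad (A z.1) z.2) (grad (B z.1) z.2)) := by
  have := hA.continuousOn_inner_grad isOpen_univ hB
  rwa [Set.univ_prod_univ, continuousOn_univ] at this

lemma continuous_inner_grad_grad (A B : C^∞⟮𝓡 d, M; ℝ⟯) :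
    Continuous (fun x => inner ℝ (grad A x) (grad B x)) := by
  have h : Continuous (fun z : ℝ × M => inner ℝ (grad A z.2) (grad B z.2)) :=
    SmoothFamily.continuous_inner_grad (A := fun _ => A) (B := fun _ => B)
      (smoothFamily_const A) (smoothFamily_const B)
  obtain ⟨G, hG⟩ : ∃ G : M → ℝ, ∀ x, inner ℝ (grad A x) (grad B x) = G x := ⟨_, fun _ => rfl⟩
  simp only [hG] at h ⊢
  exact h.comp (Continuous.prodMk_right 0)

end Algebra

/-! ### Differentiation of integral functionals along smooth paths. -/

section FiniteVolume

variable {d : ℕ} {M : Type*} [EMetricSpace M] [CompactSpace M]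
  [MeasurableSpace M] [BorelSpace M] [IsLocallyFiniteMeasure (vol d M)]

lemma integrable_of_continuous {q : M → ℝ} (hq : Continuous q) : Integrable q (vol d M) :=
  hq.integrable_of_hasCompactSupport (HasCompactSupport.of_compactSpace q)

lemma continuous_integral_of_continuous {q : ℝ × M → ℝ} (hq : Continuous q) :
    Continuous (fun ε => ∫ x, q (ε, x) ∂(vol d M)) := by
  have := continuous_parametric_integral_of_continuous (μ := vol d M) (f := fun ε x => q (ε, x))
    (by simpa [Function.uncurry_def] using hq) isCompact_univ
  simpa using this

variable [ChartedSpace (EuclideanSpace ℝ (Fin d)) M]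

lemma pairing_add_left (f g h : C^∞⟮𝓡 d, M; ℝ⟯) :
    pairing (f + g) h = pairing f h + pairing g h := by
  rw [pairing, pairing, pairing, ← integral_add
    (integrable_of_continuous (continuous_pairing_integrand f h))
    (integrable_of_continuous (continuous_pairing_integrand g h))]
  simp [add_mul]

lemma SmoothFamily.hasDerivAt_pairing [IsManifold (𝓡 d) ∞ M] {p : ℝ → C^∞⟮𝓡 d, M; ℝ⟯}
    {O : Set ℝ} (hO : IsOpen O) (hp : SmoothFamily O p) (h0 : (0 : ℝ) ∈ O) {g : C^∞⟮𝓡 d, M; ℝ⟯}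
    (hg : HasPathDeriv p g 0) (f : C^∞⟮𝓡 d, M; ℝ⟯) :
    HasDerivAt (fun ε => pairing (p ε) f) (pairing g f) 0 := by
  obtain ⟨ψ, hψ, h⟩ := hp.exists_eq_add_smul hO h0
  obtain rfl : ψ 0 = g := (hψ.hasPathDeriv h).unique hg
  have hc : Continuous (fun ε => pairing (ψ ε) f) := continuous_integral_of_continuous
    (q := fun z => ψ z.1 z.2 * f z.2)
    (hψ.continuous_uncurry.mul (f.contMDiff.continuous.comp continuous_snd))
  refine ((hasDerivAt_mul_of_continuousAt hc.continuousAt).const_add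
    (pairing (p 0) f)).congr_of_eventuallyEq ?_
  filter_upwards [h] with ε hε
  rw [zero_add] at hε
  rw [hε, pairing_add_left, pairing_smul_left]

variable [IsManifold (𝓡 d) ∞ M] [RiemannianBundle (fun x : M => TangentSpace (𝓡 d) x)]
  [IsContinuousRiemannianBundle (EuclideanSpace ℝ (Fin d)) (fun x : M => TangentSpace (𝓡 d) x)]

/-- This splitting is what recovers a joint derivative from partial ones. -/
lemma energyDeriv_eq_add (A C A' C' : C^∞⟮𝓡 d, M; ℝ⟯) :
    energyDeriv A C A' C' = energyDeriv A C A' 0 + energyDeriv A C 0 C' := by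
  simp only [energyDeriv, grad_zero, inner_zero_right, ContMDiffMap.coe_zero, Pi.zero_apply,
    mul_zero, zero_mul, add_zero, zero_add]
  refine integral_add (integrable_of_continuous ?_) (integrable_of_continuous ?_)
  · exact ((continuous_const.mul (continuous_inner_grad_grad A A'))).mul C.contMDiff.continuous
  · simp only [← real_inner_self_eq_norm_sq]
    exact (continuous_inner_grad_grad A A).mul C'.contMDiff.continuous

lemma SmoothFamily.hasDerivAt_energy {A C : ℝ → C^∞⟮𝓡 d, M; ℝ⟯} {O : Set ℝ} (hO : IsOpen O)
    (h0 : (0 : ℝ) ∈ O) (hA : SmoothFamily O A) (hC : SmoothFamily O C) {A' C' : C^∞⟮𝓡 d, M; ℝ⟯}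
    (hA' : HasPathDeriv A A' 0) (hC' : HasPathDeriv C C' 0) :
    HasDerivAt (fun ε => ∫ x, ‖grad (A ε) x‖ ^ 2 * C ε x ∂(vol d M))
      (energyDeriv (A 0) (C 0) A' C') 0 := by
  obtain ⟨a, ha, hAa⟩ := hA.exists_eq_add_smul hO h0
  obtain ⟨c, hc, hCc⟩ := hC.exists_eq_add_smul hO h0
  obtain rfl : a 0 = A' := (ha.hasPathDeriv hAa).unique hA'
  obtain rfl : c 0 = C' := (hc.hasPathDeriv hCc).unique hC'
  have hC1 : SmoothFamily Set.univ (fun ε => C 0 + ε • c ε) :=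
    (smoothFamily_const _).add (SmoothFamily.smul contDiffOn_id hc)
  -- The difference quotient in ε of |∇A|²C, obtained by expanding with A = A 0 + εa and C = C 0 +
  -- εc; it is polynomial in ε with continuous coefficients, so it makes sense at ε = 0.
  let q : ℝ × M → ℝ := fun z =>
    2 * inner ℝ (grad (A 0) z.2) (grad (a z.1) z.2) * (C 0 + z.1 • c z.1) z.2 +
      inner ℝ (grad (A 0) z.2) (grad (A 0) z.2) * c z.1 z.2 +
      z.1 * (inner ℝ (grad (a z.1) z.2) (grad (a z.1) z.2) * (C 0 + z.1 • c z.1) z.2)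
  have hq : Continuous q := by
    refine Continuous.add (Continuous.add ?_ ?_) ?_
    · exact (continuous_const.mul ((smoothFamily_const (A 0)).continuous_inner_grad ha)).mul
        hC1.continuous_uncurry
    · exact ((smoothFamily_const (A 0)).continuous_inner_grad (smoothFamily_const (A 0))).mul
        hc.continuous_uncurry
    · exact continuous_fst.mul ((ha.continuous_inner_grad ha).mul hC1.continuous_uncurry)
  have hI := continuous_integral_of_continuous (d := d) hq
  have hd := (hasDerivAt_mul_of_continuousAt hI.continuousAt).const_add
    (∫ x, ‖grad (A 0) x‖ ^ 2 * C 0 x ∂(vol d M))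
  have e0 : ∫ x, q (0, x) ∂(vol d M) = energyDeriv (A 0) (C 0) (a 0) (c 0) := by
    simp [energyDeriv, q]
  rw [e0] at hd
  refine hd.congr_of_eventuallyEq ?_
  filter_upwards [hAa, hCc] with ε hε hε'
  rw [zero_add] at hε hε'
  have hq' : Continuous (fun x => q (ε, x)) := hq.comp (Continuous.prodMk_right ε)
  have hi : Continuous (fun x => ‖grad (A 0) x‖ ^ 2 * C 0 x) := by
    simp only [← real_inner_self_eq_norm_sq]
    exact (continuous_inner_grad_grad (A 0) (A 0)).mul (C 0).contMDiff.continuous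
  rw [← integral_const_mul, ← integral_add (integrable_of_continuous hi)
    ((integrable_of_continuous hq').const_mul ε)]
  refine integral_congr_ae (Filter.Eventually.of_forall fun x => ?_)
  simp only [hε, hε', q, grad_add, grad_smul, ← real_inner_self_eq_norm_sq, inner_add_left,
    inner_add_right, inner_smul_left, inner_smul_right, ContMDiffMap.coe_add, Pi.add_apply,
    ContMDiffMap.coe_smul, Pi.smul_apply, smul_eq_mul, real_inner_comm (grad (A 0) x)]
  simp
  ring

end FiniteVolume

/-! ### First and second variations of the potential. -/

section Variations

variable {d : ℕ} {M : Type*} [EMetricSpace M] [MeasurableSpace M] [BorelSpace M]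
  [ChartedSpace (EuclideanSpace ℝ (Fin d)) M] {U : Set C^∞⟮𝓡 d, M; ℝ⟯} {F : C^∞⟮𝓡 d, M; ℝ⟯ → ℝ}

lemma IsSmoothPotential.hasFirstVariation_firstVariation (hF : IsSmoothPotential U F)
    {f : C^∞⟮𝓡 d, M; ℝ⟯} (hf : f ∈ U) : HasFirstVariation F f (firstVariation F f) := by
  have h := hF.hasFirstVariation f hf
  rw [firstVariation, dif_pos h]
  exact h.choose_spec

lemma firstVariationInv_mem {g : C^∞⟮𝓡 d, M; ℝ⟯} (hg : g ∈ firstVariation F '' U) :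
    firstVariationInv U F g ∈ U :=
  Function.invFunOn_mem hg

lemma firstVariation_firstVariationInv {g : C^∞⟮𝓡 d, M; ℝ⟯} (hg : g ∈ firstVariation F '' U) :
    firstVariation F (firstVariationInv U F g) = g :=
  Function.invFunOn_eq hg

lemma IsInvertibleFirstVariation.firstVariationInv_firstVariation
    (hinv : IsInvertibleFirstVariation U F) {f : C^∞⟮𝓡 d, M; ℝ⟯} (hf : f ∈ U) :
    firstVariationInv U F (firstVariation F f) = f :=
  hinv.injOn.leftInvOn_invFunOn hf

lemma IsSmoothPotential.smoothFamily_firstVariation_line (hF : IsSmoothPotential U F)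
    (f φ : C^∞⟮𝓡 d, M; ℝ⟯) :
    SmoothFamily {ε : ℝ | f + ε • φ ∈ U} (fun ε => firstVariation F (f + ε • φ)) :=
  hF.smooth_firstVariation ℝ _ _ (hF.isOpen.isOpen_preimage_line f φ)
    ((smoothFamily_add_smul f φ).mono (Set.subset_univ _)) fun _ h => h

variable [IsManifold (𝓡 d) ∞ M]

lemma IsSmoothPotential.hasPathDeriv_firstVariation (hF : IsSmoothPotential U F)
    {f : C^∞⟮𝓡 d, M; ℝ⟯} (hf : f ∈ U) (φ : C^∞⟮𝓡 d, M; ℝ⟯) :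
    HasPathDeriv (fun ε : ℝ => firstVariation F (f + ε • φ)) (secondVariation F f φ) 0 :=
  hF.smooth_firstVariation.hasPathDeriv_add_smul hF.isOpen hf φ

lemma IsSmoothPotential.secondVariation_add (hF : IsSmoothPotential U F)
    {f : C^∞⟮𝓡 d, M; ℝ⟯} (hf : f ∈ U) (φ ψ : C^∞⟮𝓡 d, M; ℝ⟯) :
    secondVariation F f (φ + ψ) = secondVariation F f φ + secondVariation F f ψ :=
  hF.smooth_firstVariation.dirDeriv_add hF.isOpen hf φ ψ

lemma IsSmoothPotential.secondVariation_smul (hF : IsSmoothPotential U F)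
    {f : C^∞⟮𝓡 d, M; ℝ⟯} (hf : f ∈ U) (a : ℝ) (φ : C^∞⟮𝓡 d, M; ℝ⟯) :
    secondVariation F f (a • φ) = a • secondVariation F f φ :=
  hF.smooth_firstVariation.dirDeriv_smul hF.isOpen hf a φ

lemma IsSmoothPotential.secondVariation_zero (hF : IsSmoothPotential U F)
    {f : C^∞⟮𝓡 d, M; ℝ⟯} (hf : f ∈ U) : secondVariation F f 0 = 0 := by
  simpa using hF.secondVariation_smul hf 0 0

/-- The second variation is invertible, with inverse the derivative of `(δF)⁻¹`. -/
lemma bijective_secondVariation (hF : IsSmoothPotential U F)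
    (hinv : IsInvertibleFirstVariation U F) {f : C^∞⟮𝓡 d, M; ℝ⟯} (hf : f ∈ U) :
    Function.Bijective (secondVariation F f) := by
  have hmem : firstVariation F f ∈ firstVariation F '' U := ⟨f, hf, rfl⟩
  -- Both compositions of δF with its inverse are the identity along lines, in U and in δF(U)
  -- respectively; openness keeps the lines inside for small ε, and the chain rule differentiates
  -- the identities.
  refine Function.bijective_iff_has_inverse.2
    ⟨dirDeriv (firstVariationInv U F) (firstVariation F f), fun φ => ?_, fun φ => ?_⟩
  · have hO := hF.isOpen.isOpen_preimage_line f φ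
    have h0 : (0 : ℝ) ∈ {ε : ℝ | f + ε • φ ∈ U} := by simpa using hf
    have h := hinv.smooth_inv.hasPathDeriv_comp hinv.isOpen_image hO
      (hF.smoothFamily_firstVariation_line f φ) h0 (by simpa using hmem)
      (hF.hasPathDeriv_firstVariation hf φ)
    simp only [zero_smul, add_zero] at h
    refine h.unique ((hasPathDeriv_add_smul f φ).congr ?_)
    filter_upwards [hO.mem_nhds h0] with ε hε
    exact hinv.firstVariationInv_firstVariation hε
  · have hO := hinv.isOpen_image.isOpen_preimage_line (firstVariation F f) φ
    have h0 : (0 : ℝ) ∈ {ε : ℝ | firstVariation F f + ε • φ ∈ firstVariation F '' U} := by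
      simpa using hmem
    have hfam : SmoothFamily {ε : ℝ | firstVariation F f + ε • φ ∈ firstVariation F '' U}
        (fun ε => firstVariationInv U F (firstVariation F f + ε • φ)) :=
      hinv.smooth_inv ℝ _ _ hO ((smoothFamily_add_smul _ φ).mono (Set.subset_univ _)) fun _ h => h
    have h0' : firstVariationInv U F (firstVariation F f + (0 : ℝ) • φ) = f := by
      rw [zero_smul, add_zero, hinv.firstVariationInv_firstVariation hf]
    have h := hF.smooth_firstVariation.hasPathDeriv_comp hF.isOpen hO hfam h0
      (firstVariationInv_mem h0) (hinv.smooth_inv.hasPathDeriv_add_smul hinv.isOpen_image hmem φ)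
    rw [h0'] at h
    refine h.unique ((hasPathDeriv_add_smul (firstVariation F f) φ).congr ?_)
    filter_upwards [hO.mem_nhds h0] with ε hε
    exact firstVariation_firstVariationInv hε

lemma secondVariation_secondVariationInv (hF : IsSmoothPotential U F)
    (hinv : IsInvertibleFirstVariation U F) {f : C^∞⟮𝓡 d, M; ℝ⟯} (hf : f ∈ U)
    (α : C^∞⟮𝓡 d, M; ℝ⟯) : secondVariation F f (secondVariationInv F f α) = α :=
  Function.rightInverse_invFun (bijective_secondVariation hF hinv hf).2 α

lemma secondVariationInv_eq_of_eq (hF : IsSmoothPotential U F)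
    (hinv : IsInvertibleFirstVariation U F) {f : C^∞⟮𝓡 d, M; ℝ⟯} (hf : f ∈ U)
    {α β : C^∞⟮𝓡 d, M; ℝ⟯} (h : secondVariation F f β = α) : secondVariationInv F f α = β := by
  rw [← h]
  exact Function.leftInverse_invFun (bijective_secondVariation hF hinv hf).1 β

variable [CompactSpace M] [IsLocallyFiniteMeasure (vol d M)]

/-- The second variation is a symmetric operator. -/
lemma IsSmoothPotential.pairing_secondVariation_comm (hF : IsSmoothPotential U F)
    {f : C^∞⟮𝓡 d, M; ℝ⟯} (hf : f ∈ U) (φ ψ : C^∞⟮𝓡 d, M; ℝ⟯) :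
    pairing (secondVariation F f φ) ψ = pairing φ (secondVariation F f ψ) := by
  let l : ℝ × ℝ → C^∞⟮𝓡 d, M; ℝ⟯ := fun v => v.1 • φ + v.2 • ψ
  have hl : ∀ (a : ℝ) (v w : ℝ × ℝ), l (v + a • w) = l v + a • l w := fun a v w => by
    simp only [l, Prod.fst_add, Prod.snd_add, Prod.smul_fst, Prod.smul_snd, smul_eq_mul,
      add_smul, smul_add, mul_smul]
    abel
  have hlf : SmoothFamily Set.univ (fun v => f + l v) :=
    (smoothFamily_const _).add ((SmoothFamily.smul contDiffOn_fst (smoothFamily_const _)).add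
      (SmoothFamily.smul contDiffOn_snd (smoothFamily_const _)))
  let V : Set (ℝ × ℝ) := {v | v ∈ Set.univ ∧ f + l v ∈ U}
  have hV : IsOpen V := hF.isOpen (ℝ × ℝ) Set.univ _ isOpen_univ hlf
  have h0 : (0 : ℝ × ℝ) ∈ V := ⟨trivial, by simpa [l] using hf⟩
  let u : ℝ × ℝ → ℝ := fun v => F (f + l v)
  have hu : ContDiffOn ℝ ∞ u V :=
    hF.smooth (ℝ × ℝ) V _ hV (hlf.mono (Set.subset_univ _)) fun v hv => hv.2
  have hfirst : ∀ v ∈ V, ∀ w, fderiv ℝ u v w = pairing (firstVariation F (f + l v)) (l w) := by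
    intro v hv w
    have h1 : HasDerivAt (fun ε : ℝ => u (v + ε • w)) (fderiv ℝ u v w) 0 := by
      have hd : HasFDerivAt u (fderiv ℝ u v) (v + (0 : ℝ) • w) := by
        simpa using ((hu.contDiffAt (hV.mem_nhds hv)).differentiableAt (by simp)).hasFDerivAt
      have hline : HasDerivAt (fun ε : ℝ => v + ε • w) w 0 := by
        simpa using ((hasDerivAt_id (0 : ℝ)).smul_const w).const_add v
      exact hd.comp_hasDerivAt (0 : ℝ) hline
    have h2 := hF.hasFirstVariation_firstVariation hv.2 (l w)
    refine h1.unique ?_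
    simpa only [u, hl, add_assoc] using h2
  -- The second differential of the two-parameter function u is the quadratic form of δ²F(f), so
  -- Schwarz's theorem for u is the claimed symmetry.
  have hsecond : ∀ v w, fderiv ℝ (fderiv ℝ u) 0 v w =
      pairing (secondVariation F f (l v)) (l w) := by
    intro v w
    have hd : HasFDerivAt (fderiv ℝ u) (fderiv ℝ (fderiv ℝ u) 0) ((0 : ℝ) • v) := by
      rw [zero_smul]
      exact (((hu.fderiv_of_isOpen hV (m := ∞) le_rfl).contDiffAt
        (hV.mem_nhds h0)).differentiableAt (by simp)).hasFDerivAt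
    have hline : HasDerivAt (fun ε : ℝ => ε • v) v 0 := by
      simpa using (hasDerivAt_id (0 : ℝ)).smul_const v
    have h1 : HasDerivAt (fun ε : ℝ => fderiv ℝ u (ε • v) w) (fderiv ℝ (fderiv ℝ u) 0 v w) 0 :=
      (ContinuousLinearMap.apply ℝ ℝ w).hasFDerivAt.comp_hasDerivAt (0 : ℝ)
        (hd.comp_hasDerivAt (0 : ℝ) hline)
    have h2 := (hF.smoothFamily_firstVariation_line f (l v)).hasDerivAt_pairing
      (hF.isOpen.isOpen_preimage_line f (l v)) (by simpa using hf)
      (hF.hasPathDeriv_firstVariation hf (l v)) (l w)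
    refine h1.unique (h2.congr_of_eventuallyEq ?_)
    have hcont : ContinuousAt (fun ε : ℝ => ε • v) 0 := by fun_prop
    filter_upwards [hcont.preimage_mem_nhds (by simpa using hV.mem_nhds h0)] with ε hε
    rw [hfirst _ hε]
    have : l (ε • v) = ε • l v := by simpa [l] using hl ε 0 v
    rw [this]
  have hsymm : IsSymmSndFDerivAt ℝ u 0 :=
    (hu.contDiffAt (hV.mem_nhds h0)).isSymmSndFDerivAt
      (by rw [minSmoothness_of_isRCLikeNormedField]; exact ENat.LEInfty.out)
  have h := hsymm (1, 0) (0, 1)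
  rw [hsecond, hsecond] at h
  simp only [l, one_smul, zero_smul, add_zero, zero_add] at h
  rw [h, pairing_comm]

lemma pairing_secondVariationInv_comm (hF : IsSmoothPotential U F)
    (hinv : IsInvertibleFirstVariation U F) {f : C^∞⟮𝓡 d, M; ℝ⟯} (hf : f ∈ U)
    (α β : C^∞⟮𝓡 d, M; ℝ⟯) :
    pairing (secondVariationInv F f α) β = pairing α (secondVariationInv F f β) := by
  conv_lhs => rw [← secondVariation_secondVariationInv hF hinv hf β]
  rw [← hF.pairing_secondVariation_comm hf, secondVariation_secondVariationInv hF hinv hf]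

/-! ### The operator σ and its adjoint. -/

section Sigma

variable {η ηs : C^∞⟮𝓡 d, M; ℝ⟯}

lemma pairing_sigma (hF : IsSmoothPotential U F) (hinv : IsInvertibleFirstVariation U F)
    (h : (η, ηs) ∈ hopfColeDomain U F) {α β a b : C^∞⟮𝓡 d, M; ℝ⟯}
    (ha : secondVariation F ηs a = α) (hb : secondVariation F η b = β) :
    pairing (sigma U F η ηs α) β =
      -(1 / 2) * pairing (secondVariation F (hopfCole U F (η, ηs)).1 a) b := by
  rw [sigma, pairing_smul_left, secondVariationInv_eq_of_eq hF hinv h.2.1 ha,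
    pairing_secondVariationInv_comm hF hinv h.1, secondVariationInv_eq_of_eq hF hinv h.1 hb]

/-- Swapping η and η* leaves ρ unchanged, so both sides reduce to the same value of the symmetric
form of δ²F(ρ). -/
lemma pairing_sigma_swap (hF : IsSmoothPotential U F) (hinv : IsInvertibleFirstVariation U F)
    (h : (η, ηs) ∈ hopfColeDomain U F) (α β : C^∞⟮𝓡 d, M; ℝ⟯) :
    pairing (sigma U F ηs η α) β = pairing α (sigma U F η ηs β) := by
  have h' : (ηs, η) ∈ hopfColeDomain U F := ⟨h.2.1, h.1, by rw [add_comm]; exact h.2.2⟩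
  have e : (hopfCole U F (ηs, η)).1 = (hopfCole U F (η, ηs)).1 := by
    simp only [hopfCole, add_comm]
  have hρ : (hopfCole U F (η, ηs)).1 ∈ U := firstVariationInv_mem h.2.2
  have s1 := secondVariation_secondVariationInv hF hinv h.1
  have s2 := secondVariation_secondVariationInv hF hinv h.2.1
  rw [pairing_sigma hF hinv h' (s1 α) (s2 β), pairing_comm α,
    pairing_sigma hF hinv h (s2 β) (s1 α), e, hF.pairing_secondVariation_comm hρ, pairing_comm]

end Sigma

/-! ### Derivatives of the Hamiltonian in both sets of variables. -/

section Hamiltonian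

variable [RiemannianBundle (fun x : M => TangentSpace (𝓡 d) x)]
  [IsContinuousRiemannianBundle (EuclideanSpace ℝ (Fin d)) (fun x : M => TangentSpace (𝓡 d) x)]

lemma IsSmoothPotential.hasDerivAt_hamiltonian_energyDeriv (hF : IsSmoothPotential U F)
    {ρ S : ℝ → C^∞⟮𝓡 d, M; ℝ⟯} {O : Set ℝ} (hO : IsOpen O) (h0 : (0 : ℝ) ∈ O)
    (hρ : SmoothFamily O ρ) (hS : SmoothFamily O S) (hU : ∀ ε ∈ O, ρ ε ∈ U)
    {ρ' S' : C^∞⟮𝓡 d, M; ℝ⟯} (hρ' : HasPathDeriv ρ ρ' 0) (hS' : HasPathDeriv S S' 0) :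
    HasDerivAt (fun ε => hamiltonian F (ρ ε) (S ε))
      (1 / 2 * energyDeriv (S 0) (ρ 0) S' ρ' - 1 / 2 * energyDeriv (firstVariation F (ρ 0)) (ρ 0)
        (secondVariation F (ρ 0) ρ') ρ') 0 := by
  have hA : SmoothFamily O (fun ε => firstVariation F (ρ ε)) :=
    hF.smooth_firstVariation ℝ O ρ hO hρ hU
  have hA' := hF.smooth_firstVariation.hasPathDeriv_comp hF.isOpen hO hρ h0 (hU 0 h0) hρ'
  exact ((hS.hasDerivAt_energy hO h0 hρ hS' hρ').const_mul _).sub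
    ((hA.hasDerivAt_energy hO h0 hρ hA' hρ').const_mul _)

/-- The chain rule for the Hamiltonian, in terms of its partial `L²` gradients. -/
lemma IsSmoothPotential.hasDerivAt_hamiltonian (hF : IsSmoothPotential U F)
    {ρ S : ℝ → C^∞⟮𝓡 d, M; ℝ⟯} {O : Set ℝ} (hO : IsOpen O) (h0 : (0 : ℝ) ∈ O)
    (hρ : SmoothFamily O ρ) (hS : SmoothFamily O S) (hU : ∀ ε ∈ O, ρ ε ∈ U)
    {ρ' S' g₁ g₂ : C^∞⟮𝓡 d, M; ℝ⟯} (hρ' : HasPathDeriv ρ ρ' 0) (hS' : HasPathDeriv S S' 0)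
    (hg₁ : HasFirstVariation (fun T => hamiltonian F (ρ 0) T) (S 0) g₁)
    (hg₂ : HasFirstVariation (fun r => hamiltonian F r (S 0)) (ρ 0) g₂) :
    HasDerivAt (fun ε => hamiltonian F (ρ ε) (S ε)) (pairing g₂ ρ' + pairing g₁ S') 0 := by
  have h := hF.hasDerivAt_hamiltonian_energyDeriv hO h0 hρ hS hU hρ' hS'
  -- Freezing ρ, then S, expresses the pairings with g₁ and g₂ through the same integrals as the
  -- joint derivative.
  have h1 := hF.hasDerivAt_hamiltonian_energyDeriv isOpen_univ (Set.mem_univ 0)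
    (smoothFamily_const (ρ 0)) (smoothFamily_add_smul (S 0) S') (fun _ _ => hU 0 h0)
    (hasPathDeriv_const (ρ 0) 0) (hasPathDeriv_add_smul (S 0) S')
  have h2 := hF.hasDerivAt_hamiltonian_energyDeriv (hF.isOpen.isOpen_preimage_line (ρ 0) ρ')
    (by simpa using hU 0 h0) ((smoothFamily_add_smul (ρ 0) ρ').mono (Set.subset_univ _))
    (smoothFamily_const (S 0)) (fun _ h => h) (hasPathDeriv_add_smul (ρ 0) ρ')
    (hasPathDeriv_const (S 0) 0)
  have e1 := (hg₁ S').unique h1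
  have e2 := (hg₂ ρ').unique h2
  have e3 : energyDeriv (firstVariation F (ρ 0)) (ρ 0) 0 0 = 0 := by
    simp [energyDeriv, grad_zero]
  simp only [zero_smul, add_zero, hF.secondVariation_zero (hU 0 h0), e3] at e1 e2
  rw [energyDeriv_eq_add (S 0) (ρ 0) S' ρ'] at h
  convert h using 1
  rw [e1, e2]
  ring

/-- The derivative of the Hamiltonian along a path given by `δF(ρ) = a + b` and `S = a - b`. -/
lemma hasDerivAt_hamiltonian_hopfCole (hF : IsSmoothPotential U F)
    (hinv : IsInvertibleFirstVariation U F) {a b : ℝ → C^∞⟮𝓡 d, M; ℝ⟯} {O : Set ℝ}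
    (hO : IsOpen O) (h0 : (0 : ℝ) ∈ O) (ha : SmoothFamily O a) (hb : SmoothFamily O b)
    {a' b' ρ S g₁ g₂ : C^∞⟮𝓡 d, M; ℝ⟯} (ha' : HasPathDeriv a a' 0) (hb' : HasPathDeriv b b' 0)
    (hab : a 0 + b 0 ∈ firstVariation F '' U) (hρ : firstVariationInv U F (a 0 + b 0) = ρ)
    (hS : a 0 - b 0 = S)
    (hg₁ : HasFirstVariation (fun T => hamiltonian F ρ T) S g₁)
    (hg₂ : HasFirstVariation (fun r => hamiltonian F r S) ρ g₂) :
    HasDerivAt (fun ε => hamiltonian F (firstVariationInv U F (a ε + b ε)) (a ε - b ε))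
      (pairing g₂ (secondVariationInv F ρ (a' + b')) + pairing g₁ (a' - b')) 0 := by
  have hO' := hinv.isOpen_image ℝ O _ hO (ha.add hb)
  set O' : Set ℝ := {ε | ε ∈ O ∧ a ε + b ε ∈ firstVariation F '' U}
  have hsub : O' ⊆ O := fun ε hε => hε.1
  have h0' : (0 : ℝ) ∈ O' := ⟨h0, hab⟩
  have hr : SmoothFamily O' (fun ε => firstVariationInv U F (a ε + b ε)) :=
    hinv.smooth_inv ℝ O' _ hO' ((ha.add hb).mono hsub) fun ε hε => hε.2
  obtain ⟨r', hr'⟩ := hr.exists_hasPathDeriv hO' h0'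
  have hρU : ρ ∈ U := hρ ▸ firstVariationInv_mem hab
  -- Differentiating δF(ρ_ε) = a + b identifies the velocity of ρ_ε as [δ²F(ρ)]⁻¹(a' + b').
  have key : secondVariation F ρ r' = a' + b' := by
    have h1 := hF.smooth_firstVariation.hasPathDeriv_comp hF.isOpen hO' hr h0'
      (firstVariationInv_mem hab) hr'
    simp only [hρ] at h1
    refine h1.unique ((ha'.add hb').congr ?_)
    filter_upwards [hO'.mem_nhds h0'] with ε hε
    exact firstVariation_firstVariationInv hε.2
  rw [secondVariationInv_eq_of_eq hF hinv hρU key]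
  exact hF.hasDerivAt_hamiltonian hO' h0' hr ((ha.sub hb).mono hsub)
    (fun ε hε => firstVariationInv_mem hε.2) hr' (ha'.sub hb') (by simpa only [hρ, hS] using hg₁)
    (by simpa only [hρ, hS] using hg₂)

variable {η ηs ρ S g₁ g₂ : C^∞⟮𝓡 d, M; ℝ⟯}

/-- Varying η moves only a, with velocity δ²F(η)φ. Symmetry of δ²F(η) and of [δ²F(ρ)]⁻¹ moves these
operators off φ and onto g₁ and g₂. -/
lemma hasFirstVariation_hopfColeHamiltonian_left (hF : IsSmoothPotential U F)
    (hinv : IsInvertibleFirstVariation U F) (h : (η, ηs) ∈ hopfColeDomain U F)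
    (hs : hopfCole U F (η, ηs) = (ρ, S))
    (hg₁ : HasFirstVariation (fun T => hamiltonian F ρ T) S g₁)
    (hg₂ : HasFirstVariation (fun r => hamiltonian F r S) ρ g₂) :
    HasFirstVariation (fun ξ => hopfColeHamiltonian U F ξ ηs) η
      (secondVariation F η (secondVariationInv F ρ g₂ + g₁)) := by
  intro φ
  obtain ⟨hρ, hS⟩ := Prod.mk.inj hs
  have hρU : ρ ∈ U := hρ ▸ firstVariationInv_mem h.2.2
  have key := hasDerivAt_hamiltonian_hopfCole hF hinv (hF.isOpen.isOpen_preimage_line η φ)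
    (by simpa using h.1) (hF.smoothFamily_firstVariation_line η φ)
    (smoothFamily_const (firstVariation F ηs)) (hF.hasPathDeriv_firstVariation h.1 φ)
    (hasPathDeriv_const _ 0) (by simpa using h.2.2) (by simpa using hρ) (by simpa using hS) hg₁ hg₂
  rw [hF.pairing_secondVariation_comm h.1, pairing_add_left,
    pairing_secondVariationInv_comm hF hinv hρU]
  rw [add_zero, sub_zero] at key
  exact key

/-- The same argument for b; the sign of g₁ flips because S = a - b. -/
lemma hasFirstVariation_hopfColeHamiltonian_right (hF : IsSmoothPotential U F)
    (hinv : IsInvertibleFirstVariation U F) (h : (η, ηs) ∈ hopfColeDomain U F)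
    (hs : hopfCole U F (η, ηs) = (ρ, S))
    (hg₁ : HasFirstVariation (fun T => hamiltonian F ρ T) S g₁)
    (hg₂ : HasFirstVariation (fun r => hamiltonian F r S) ρ g₂) :
    HasFirstVariation (fun ξ => hopfColeHamiltonian U F η ξ) ηs
      (secondVariation F ηs (secondVariationInv F ρ g₂ + (-1 : ℝ) • g₁)) := by
  intro φ
  obtain ⟨hρ, hS⟩ := Prod.mk.inj hs
  have hρU : ρ ∈ U := hρ ▸ firstVariationInv_mem h.2.2
  have key := hasDerivAt_hamiltonian_hopfCole hF hinv (hF.isOpen.isOpen_preimage_line ηs φ)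
    (by simpa using h.2.1) (smoothFamily_const (firstVariation F η))
    (hF.smoothFamily_firstVariation_line ηs φ) (hasPathDeriv_const _ 0)
    (hF.hasPathDeriv_firstVariation h.2.1 φ)
    (by simpa using h.2.2) (by simpa using hρ) (by simpa using hS) hg₁ hg₂
  rw [hF.pairing_secondVariation_comm h.2.1, pairing_add_left, pairing_smul_left,
    pairing_secondVariationInv_comm hF hinv hρU]
  have e : pairing g₁ (0 - secondVariation F ηs φ) =
      -1 * pairing g₁ (secondVariation F ηs φ) := by
    rw [pairing_comm, pairing_comm g₁, ← pairing_smul_left]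
    simp
  rw [zero_add, e] at key
  exact key

end Hamiltonian

end Variations

end HopfCole

end

/-! ### The theorem. -/

open HopfCole in
theorem mainTheorem2 {d : ℕ} {M : Type*} [EMetricSpace M] [CompactSpace M]
    [MeasurableSpace M] [BorelSpace M]
    [ChartedSpace (EuclideanSpace ℝ (Fin d)) M] [IsManifold (𝓡 d) ∞ M]
    [RiemannianBundle (fun x : M => TangentSpace (𝓡 d) x)]
    [IsContMDiffRiemannianBundle (𝓡 d) ∞ (EuclideanSpace ℝ (Fin d))
      (fun x : M => TangentSpace (𝓡 d) x)]
    [IsRiemannianManifold (𝓡 d) M]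
    (U : Set C^∞⟮𝓡 d, M; ℝ⟯) (F : C^∞⟮𝓡 d, M; ℝ⟯ → ℝ)
    (hF : IsSmoothPotential U F) (hinv : IsInvertibleFirstVariation U F) :
    -- the equations satisfied by the Hopf--Cole variables along the flow
    (∀ (J : Set ℝ) (ρ S η ηs : ℝ → C^∞⟮𝓡 d, M; ℝ⟯), IsOpen J → IsHamiltonianFlow J U F ρ S →
      (∀ t ∈ J, (η t, ηs t) ∈ hopfColeDomain U F ∧ hopfCole U F (η t, ηs t) = (ρ t, S t)) →
      SmoothFamily J η ∧ SmoothFamily J ηs ∧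
      ∀ t ∈ J, ∃ κ κs : C^∞⟮𝓡 d, M; ℝ⟯,
        HasFirstVariation (fun ξ => hopfColeHamiltonian U F ξ (ηs t)) (η t) κ ∧
        HasFirstVariation (fun ξ => hopfColeHamiltonian U F (η t) ξ) (ηs t) κs ∧
        HasPathDeriv η (sigma U F (η t) (ηs t) κs) t ∧
        HasPathDeriv ηs (-sigma U F (ηs t) (η t) κ) t) ∧
    -- the operator `σ`: the inverses exist, the formula on test functions, and the adjoint
    (∀ f ∈ U, Function.Bijective (secondVariation F f)) ∧
    ∀ η ηs : C^∞⟮𝓡 d, M; ℝ⟯, (η, ηs) ∈ hopfColeDomain U F →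
      (∀ α β a b : C^∞⟮𝓡 d, M; ℝ⟯, secondVariation F ηs a = α → secondVariation F η b = β →
        pairing (sigma U F η ηs α) β =
          -(1 / 2) * pairing (secondVariation F (hopfCole U F (η, ηs)).1 a) b) ∧
      (∀ α β : C^∞⟮𝓡 d, M; ℝ⟯,
        pairing (sigma U F ηs η α) β = pairing α (sigma U F η ηs β)) := by
  have : IsManifold (𝓡 d) 1 M := IsManifold.of_le (n := ∞) (by simp)
  have : IsContinuousRiemannianBundle (EuclideanSpace ℝ (Fin d))
      (fun x : M => TangentSpace (𝓡 d) x) := by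
    obtain ⟨g, hg, h⟩ := IsContMDiffRiemannianBundle.exists_contMDiff (IB := 𝓡 d) (n := ∞)
      (F := EuclideanSpace ℝ (Fin d)) (E := fun x : M => TangentSpace (𝓡 d) x)
    exact ⟨g, hg.continuous, h⟩
  have : IsLocallyFiniteMeasure (vol d M) := isLocallyFiniteMeasure_vol
  refine ⟨fun J ρ S η ηs hJ hflow hs => ?_, fun f hf => bijective_secondVariation hF hinv hf,
    fun η ηs h => ⟨fun α β a b ha hb => pairing_sigma hF hinv h ha hb,
      fun α β => pairing_sigma_swap hF hinv h α β⟩⟩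
  have hsum : ∀ t ∈ J, firstVariation F (η t) + firstVariation F (ηs t) = firstVariation F (ρ t) :=
    fun t ht => by
      rw [← (Prod.mk.inj (hs t ht).2).1, firstVariation_firstVariationInv (hs t ht).1.2.2]
  have hdiff : ∀ t ∈ J, firstVariation F (η t) - firstVariation F (ηs t) = S t :=
    fun t ht => (Prod.mk.inj (hs t ht).2).2
  have hη_eq : ∀ t ∈ J, firstVariation F (η t) =
      (1 / 2 : ℝ) • (firstVariation F (ρ t) + S t) := fun t ht => by
    rw [← hsum t ht, ← hdiff t ht]
    module
  have hηs_eq : ∀ t ∈ J, firstVariation F (ηs t) =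
      (1 / 2 : ℝ) • (firstVariation F (ρ t) - S t) := fun t ht => by
    rw [← hsum t ht, ← hdiff t ht]
    module
  have hA : SmoothFamily J (fun t => firstVariation F (ρ t)) :=
    hF.smooth_firstVariation ℝ J ρ hJ hflow.smooth_density hflow.mem_domain
  -- A path in U inherits smoothness from its image under δF, since the inverse of δF is smooth; for
  -- η and η* that image is ½(δF(ρ) ± S).
  have hsm : ∀ ξ : ℝ → C^∞⟮𝓡 d, M; ℝ⟯, (∀ t ∈ J, ξ t ∈ U) →
      SmoothFamily J (fun t => firstVariation F (ξ t)) → SmoothFamily J ξ := fun ξ hξ h =>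
    (hinv.smooth_inv ℝ J _ hJ h fun t ht => ⟨_, hξ t ht, rfl⟩).congr fun t ht =>
      (hinv.firstVariationInv_firstVariation (hξ t ht)).symm
  have hη : SmoothFamily J η := hsm η (fun t ht => (hs t ht).1.1)
    ((SmoothFamily.smul contDiffOn_const (hA.add hflow.smooth_momentum)).congr hη_eq)
  have hηs : SmoothFamily J ηs := hsm ηs (fun t ht => (hs t ht).1.2.1)
    ((SmoothFamily.smul contDiffOn_const (hA.sub hflow.smooth_momentum)).congr hηs_eq)
  refine ⟨hη, hηs, fun t ht => ?_⟩
  obtain ⟨g₁, hg₁, hρ'⟩ := hflow.density_eq t ht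
  obtain ⟨g₂, hg₂, hS'⟩ := hflow.momentum_eq t ht
  obtain ⟨hdom, hst⟩ := hs t ht
  have hρU := hflow.mem_domain t ht
  have hA' := hF.smooth_firstVariation.hasPathDeriv_comp hF.isOpen hJ
    hflow.smooth_density ht hρU hρ'
  have hηρ : (hopfCole U F (η t, ηs t)).1 = ρ t := by rw [hst]
  have hηρ' : (hopfCole U F (ηs t, η t)).1 = ρ t := by
    rw [← hηρ]
    simp only [hopfCole, add_comm]
  refine ⟨_, _, hasFirstVariation_hopfColeHamiltonian_left hF hinv hdom hst hg₁ hg₂,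
    hasFirstVariation_hopfColeHamiltonian_right hF hinv hdom hst hg₁ hg₂, ?_, ?_⟩
  · obtain ⟨η', hη'⟩ := hη.exists_hasPathDeriv hJ ht
    have h1 := hF.smooth_firstVariation.hasPathDeriv_comp hF.isOpen hJ hη ht hdom.1 hη'
    have h2 : secondVariation F (η t) η' = (1 / 2 : ℝ) • (secondVariation F (ρ t) g₁ + -g₂) :=
      h1.unique (((hA'.add hS').const_smul _).congr ((hJ.eventually_mem ht).mono hη_eq))
    -- The factor -2 cancels the -½ in σ, and the right side is δ²F(ρ)[δ²F(η*)]⁻¹ applied to the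
    -- gradient of K in η*.
    have h3 : secondVariation F (η t) ((-2 : ℝ) • η') =
        secondVariation F (ρ t) (secondVariationInv F (ρ t) g₂ + (-1 : ℝ) • g₁) := by
      rw [hF.secondVariation_smul hdom.1, h2, hF.secondVariation_add hρU,
        hF.secondVariation_smul hρU, secondVariation_secondVariationInv hF hinv hρU]
      module
    rw [sigma, hηρ, secondVariationInv_eq_of_eq hF hinv hdom.2.1 rfl,
      secondVariationInv_eq_of_eq hF hinv hdom.1 h3, smul_smul]
    norm_num
    exact hη'
  · obtain ⟨η', hη'⟩ := hηs.exists_hasPathDeriv hJ ht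
    have h1 := hF.smooth_firstVariation.hasPathDeriv_comp hF.isOpen hJ hηs ht hdom.2.1 hη'
    have h2 : secondVariation F (ηs t) η' = (1 / 2 : ℝ) • (secondVariation F (ρ t) g₁ - -g₂) :=
      h1.unique (((hA'.sub hS').const_smul _).congr ((hJ.eventually_mem ht).mono hηs_eq))
    -- Here the factor is +2, because the equation for η* carries an extra minus sign in front of σ.
    have h3 : secondVariation F (ηs t) ((2 : ℝ) • η') =
        secondVariation F (ρ t) (secondVariationInv F (ρ t) g₂ + g₁) := by
      rw [hF.secondVariation_smul hdom.2.1, h2, hF.secondVariation_add hρU,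
        secondVariation_secondVariationInv hF hinv hρU]
      module
    rw [sigma, hηρ', secondVariationInv_eq_of_eq hF hinv hdom.1 rfl,
      secondVariationInv_eq_of_eq hF hinv hdom.2.1 h3, smul_smul]
    norm_num
    exact hη'
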